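/- For integers $d\ge 2$ and $\ell\ge 0$ let $Y_{\ell 1},\dots,Y_{\ell n_{\ell d}}$ be an orthonormal basis of the space of real hyperspherical harmonics of degree $\ell$ on the unit sphere $S^d\subset\mathbb{R}^{d+1}$, i.e. of the eigenspace $\{f\in C^\infty(S^d):\Delta_{S^d}f=-\ell(\ell+d-1)f\}$ of the Laplace–Beltrami operator, with respect to the inner product of $L^2(S^d,\mu)$, where $\mu$ is the normalized (probability) surface measure and $n_{\ell d}$ is the dimension of the eigenspace. For $\alpha=(\alpha_1,\dots,\alpha_{n_{\ell d}})$ in the unit sphere of $\mathbb{R}^{n_{\ell d}}$ put $h_{\alpha,\ell,d}=\sum_{m=1}^{n_{\ell d}}\alpha_m Y_{\ell m}$. Let $X$ be uniformly distributed on $S^d$, let $\Phi$ be the distribution function of a standard Gaussian variable $Z$, and let $$d_{Kol}(h_{\alpha,\ell,d}(X),Z)=\sup_{u\in\mathbb{R}}\bigl|\mu\{x\in S^d:h_{\alpha,\ell,d}(x)\le u\}-\Phi(u)\bigr| .$$ Let $\mathbb{E}$ denote the expectation over $\alpha$ distributed uniformly on the unit sphere of $\mathbb{R}^{n_{\ell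 d}}$. Then $\alpha\mapsto d_{Kol}(h_{\alpha,\ell,d}(X),Z)$ is integrable, for every fixed $\ell\ge 0$ $$\mathbb{E}\left[d_{Kol}(h_{\alpha,\ell,d}(X),Z)\right]=O\left(\frac{1}{d^{\ell/3}}\right)\qquad (d\to\infty),$$ and for every fixed $d\ge 2$ $$\mathbb{E}\left[d_{Kol}(h_{\alpha,\ell,d}(X),Z)\right]=O\left(\frac{1}{\ell^{(d-1)/3}}\right)\qquad (\ell\to\infty).$$ -/

import Mathlib

open MeasureTheory ProbabilityTheory Filter Asymptotics
open scoped ContDiff Laplacian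

noncomputable section

/-- The unit sphere `S^(k-1)` of the Euclidean space `ℝ^k`. -/
abbrev UnitSphere (k : ℕ) : Type := Metric.sphere (0 : EuclideanSpace ℝ (Fin k)) 1

/-- The uniform distribution (normalized surface measure) on the unit sphere of `ℝ^k`. -/
def uniformSphere (k : ℕ) : Measure (UnitSphere k) :=
  ((volume : Measure (EuclideanSpace ℝ (Fin k))).toSphere Set.univ)⁻¹ •
    (volume : Measure (EuclideanSpace ℝ (Fin k))).toSphere

open Classical in
/-- The radial (degree zero homogeneous) extension `y ↦ f (y / ‖y‖)` of a function on the unit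
sphere to the punctured space; its value at the origin is irrelevant and set to `0`. -/
def radialExtension {k : ℕ} (f : UnitSphere k → ℝ) (y : EuclideanSpace ℝ (Fin k)) : ℝ :=
  if hy : y = 0 then 0
  else f ⟨‖y‖⁻¹ • y, by
    rw [mem_sphere_zero_iff_norm, norm_smul, norm_inv, norm_norm,
      inv_mul_cancel₀ (norm_ne_zero_iff.mpr hy)]⟩

/-- Smoothness of a function on the sphere: its radial extension is `C^∞` off the origin. -/
def SmoothOnSphere {k : ℕ} (f : UnitSphere k → ℝ) : Prop :=
  ContDiffOn ℝ ∞ (radialExtension f) {0}ᶜ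

/-- The Laplace-Beltrami operator of the round unit sphere, as the restriction to the sphere of
the Euclidean Laplacian of the radial extension. -/
def sphereLaplacian {k : ℕ} (f : UnitSphere k → ℝ) (x : UnitSphere k) : ℝ :=
  (Δ (radialExtension f)) (x : EuclideanSpace ℝ (Fin k))

/-- Real hyperspherical harmonics of degree `ℓ` on `S^d`: the smooth `f` with
`Δ f = -ℓ (ℓ + d - 1) f`. -/
def IsSphericalHarmonic (d ℓ : ℕ) (f : UnitSphere (d + 1) → ℝ) : Prop :=
  SmoothOnSphere f ∧
    ∀ x, sphereLaplacian f x = -((ℓ : ℝ) * ((ℓ : ℝ) + (d : ℝ) - 1)) * f x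

/-- `Y 0, …, Y (n-1)` is an orthonormal basis, with respect to the inner product of `L²` of the
normalized surface measure, of the space of hyperspherical harmonics of degree `ℓ` on `S^d`.
In particular `n` is the dimension of this space. -/
structure IsHarmonicBasis (d ℓ : ℕ) {n : ℕ} (Y : Fin n → UnitSphere (d + 1) → ℝ) : Prop where
  harmonic : ∀ m, IsSphericalHarmonic d ℓ (Y m)
  orthonormal : ∀ m m', ∫ x, Y m x * Y m' x ∂(uniformSphere (d + 1)) = if m = m' then 1 else 0
  spanning : ∀ f, IsSphericalHarmonic d ℓ f → ∃ c : Fin n → ℝ, ∀ x, f x = ∑ m, c m * Y m x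

/-- The eigenfunction `h_α = ∑ m, α_m Y_m` with coefficient vector `α` on the unit sphere. -/
def eigenfunction {d n : ℕ} (Y : Fin n → UnitSphere (d + 1) → ℝ) (α : UnitSphere n)
    (x : UnitSphere (d + 1)) : ℝ :=
  ∑ m, (α : EuclideanSpace ℝ (Fin n)) m * Y m x

/-- The Kolmogorov distance of two probability measures on `ℝ`. -/
def kolmogorovDist (P Q : Measure ℝ) : ℝ :=
  ⨆ u : ℝ, |P.real (Set.Iic u) - Q.real (Set.Iic u)|

/-- The Kolmogorov distance between `h_α (X)`, with `X` uniform on `S^d`, and a standard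
Gaussian variable. -/
def gaussianDefect {d n : ℕ} (Y : Fin n → UnitSphere (d + 1) → ℝ) (α : UnitSphere n) : ℝ :=
  kolmogorovDist ((uniformSphere (d + 1)).map (eigenfunction Y α)) (gaussianReal 0 1)

end

/-!
The mean Gaussian defect is at most a universal constant times `n ^ (-1/3)`, where `n` is the
dimension of the eigenspace (`exists_integral_gaussianDefect_le`), and `n` is at least
`(ℓ + d - 1).choose (d - 1)` (`IsHarmonicBasis.choose_le`); both asymptotic bounds follow.

For the first fact, replace the uniform coefficient vector by `g / ‖g‖` with `g` standard Gaussian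
(`integral_uniformSphere_eq_stdGaussian`). The addition theorem `∑ m, Y_m(x) ^ 2 = n`
(`IsHarmonicBasis.sum_sq_eq`) says that `e(x) = (Y_m(x) / √n)_m` is a unit vector, so
`T(x) = ⟪e(x), g⟫` is a Gaussian field on the sphere with unit variances and correlation kernel
`ρ(x, y) = ⟪e(x), e(y)⟫`. The eigenfunction with coefficients `g / ‖g‖` is `T` rescaled by
`√n / ‖g‖`, and since the Kolmogorov distance is a supremum over all levels, the rescaling costs only
a multiple of `|‖g‖ ^ 2 / n - 1|`, which is of order `n ^ (-1/2)` in mean. The proportion of the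
sphere on which `T ≤ u` has mean `Φ u`. Its variance is the integral over pairs of points of the
covariance of the events `T(x) ≤ u` and `T(y) ≤ u`, which is at most `ρ φ(u) ^ 2 + 8 ρ ^ 2`
(`stdGaussian_quadrant_le`). Orthonormality gives `∬ ρ ^ 2 = 1 / n`, and Bessel's inequality for the
constant function gives `∬ ρ ≤ 1 / n`; hence the variance is at most `9 / n`
(`integral_fieldCDF_sub_sq_le`). Comparing the two distribution functions only at the `N`-quantiles
of `Φ` loses `1 / N`, while the sum of the `N` variances, weighted by `N`, contributes `N ^ 2 / n`;
`N ≈ n ^ (1/3)` balances the two.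

For the second fact, homogeneous harmonic polynomials restrict to spherical harmonics
(`isSphericalHarmonic_polyEval`), and rank-nullity for the Laplacian from degree `ℓ` to degree
`ℓ - 2` bounds the dimension of their space from below.
-/

/-! ### The uniform measure on the sphere and the standard Gaussian measure -/

lemma radialExtension_apply {k : ℕ} (f : UnitSphere k → ℝ) {y : EuclideanSpace ℝ (Fin k)}
    (hy : y ≠ 0) (h : ‖y‖⁻¹ • y ∈ Metric.sphere (0 : EuclideanSpace ℝ (Fin k)) 1) :
    radialExtension f y = f ⟨‖y‖⁻¹ • y, h⟩ := by
  rw [radialExtension, dif_neg hy]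

lemma radialExtension_smul {k : ℕ} (f : UnitSphere k → ℝ) (x : UnitSphere k) {r : ℝ}
    (hr : 0 < r) : radialExtension f (r • (x : EuclideanSpace ℝ (Fin k))) = f x := by
  have hx : ‖(x : EuclideanSpace ℝ (Fin k))‖ = 1 := by simp
  have h0 : r • (x : EuclideanSpace ℝ (Fin k)) ≠ 0 := by
    rw [← norm_ne_zero_iff, norm_smul, hx]; simpa using hr.ne'
  rw [radialExtension, dif_neg h0]
  congr 1
  ext1
  simp [norm_smul, abs_of_pos hr, smul_smul, hr.ne']

lemma radialExtension_coe {k : ℕ} (f : UnitSphere k → ℝ) (x : UnitSphere k) :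
    radialExtension f (x : EuclideanSpace ℝ (Fin k)) = f x := by
  simpa using radialExtension_smul f x one_pos

instance isProbabilityMeasure_uniformSphere (k : ℕ) [NeZero k] :
    IsProbabilityMeasure (uniformSphere k) := by
  constructor
  rw [uniformSphere, Measure.smul_apply, smul_eq_mul, ENNReal.inv_mul_cancel]
  · exact (Measure.measure_univ_ne_zero).2 (Measure.toSphere_ne_zero _)
  · exact measure_ne_top _ _

/-- The standard Gaussian measure has density proportional to `exp (-‖x‖² / 2)`. -/
lemma stdGaussian_eq_withDensity (k : ℕ) :
    stdGaussian (EuclideanSpace ℝ (Fin k)) =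
      (volume : Measure (EuclideanSpace ℝ (Fin k))).withDensity fun x =>
        ENNReal.ofReal (((2 * Real.pi) ^ ((k : ℝ) / 2))⁻¹ * Real.exp (-(1 / 2) * ‖x‖ ^ 2)) := by
  have hint : ∀ t : EuclideanSpace ℝ (Fin k),
      ∫ v : EuclideanSpace ℝ (Fin k), Complex.exp (-(1 / 2 : ℂ) * ‖v‖ ^ 2 +
        Complex.I * (inner ℝ t v : ℝ)) =
      ((2 * Real.pi) ^ ((k : ℝ) / 2) : ℝ) * Complex.exp (-‖t‖ ^ 2 / 2) := by
    intro t
    rw [GaussianFourier.integral_cexp_neg_mul_sq_norm_add (by norm_num)]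
    congr 1
    · rw [Complex.ofReal_cpow (by positivity)]
      simp only [finrank_euclideanSpace, Fintype.card_fin]
      push_cast
      congr 1
      ring
    · congr 1
      rw [Complex.I_sq]
      ring
  have hpos : (0 : ℝ) < (2 * Real.pi) ^ ((k : ℝ) / 2) := by positivity
  have hfin : IsFiniteMeasure ((volume : Measure (EuclideanSpace ℝ (Fin k))).withDensity fun x =>
        ENNReal.ofReal (((2 * Real.pi) ^ ((k : ℝ) / 2))⁻¹ *
          Real.exp (-(1 / 2) * ‖x‖ ^ 2))) := by
    refine isFiniteMeasure_withDensity_ofReal (Integrable.hasFiniteIntegral ?_)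
    refine Integrable.const_mul ?_ _
    have := GaussianFourier.integrable_cexp_neg_mul_sq_norm_add (V := EuclideanSpace ℝ (Fin k))
      (b := 1 / 2) (by norm_num) 0 0
    have h2 := this.norm
    refine h2.congr (Eventually.of_forall fun x => ?_)
    simp only [Complex.norm_exp]
    congr 1
    have : -(1 / 2 : ℂ) * ‖x‖ ^ 2 + 0 * (inner ℝ 0 x : ℝ) = ((-(1 / 2) * ‖x‖ ^ 2 : ℝ) : ℂ) := by
      push_cast
      ring
    rw [this, Complex.ofReal_re]
  refine Measure.ext_of_charFun ?_
  ext t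
  rw [charFun_stdGaussian, charFun_apply]
  have hm : Measurable fun x : EuclideanSpace ℝ (Fin k) =>
      (((2 * Real.pi) ^ ((k : ℝ) / 2))⁻¹ * Real.exp (-(1 / 2) * ‖x‖ ^ 2)) := by fun_prop
  rw [integral_withDensity_eq_integral_toReal_smul (by fun_prop) (by simp)]
  have : ∀ x : EuclideanSpace ℝ (Fin k),
      (ENNReal.ofReal (((2 * Real.pi) ^ ((k : ℝ) / 2))⁻¹ *
        Real.exp (-(1 / 2) * ‖x‖ ^ 2))).toReal • Complex.exp (inner ℝ x t * Complex.I) =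
      (((2 * Real.pi) ^ ((k : ℝ) / 2) : ℝ) : ℂ)⁻¹ *
        Complex.exp (-(1 / 2 : ℂ) * ‖x‖ ^ 2 + Complex.I * (inner ℝ t x : ℝ)) := by
    intro x
    rw [ENNReal.toReal_ofReal (by positivity), Complex.exp_add, Complex.real_smul,
      real_inner_comm]
    push_cast
    ring_nf
  simp_rw [this]
  rw [integral_const_mul, hint]
  have : ((((2 * Real.pi) ^ ((k : ℝ) / 2) : ℝ)) : ℂ) ≠ 0 := by exact_mod_cast hpos.ne'
  field_simp

/-- A standard Gaussian vector, normalized to length one, is uniformly distributed on the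
sphere. -/
theorem integral_uniformSphere_eq_stdGaussian (k : ℕ) [NeZero k] (f : UnitSphere k → ℝ) :
    ∫ x, f x ∂(uniformSphere k) =
      ∫ g, radialExtension f g ∂(stdGaussian (EuclideanSpace ℝ (Fin k))) := by
  obtain ⟨A, hA⟩ : ∃ A : ℝ, ∀ f : UnitSphere k → ℝ,
      ∫ g, radialExtension f g ∂(stdGaussian (EuclideanSpace ℝ (Fin k))) =
        A * ∫ x, f x ∂(volume : Measure (EuclideanSpace ℝ (Fin k))).toSphere := by
    set μ := (volume : Measure (EuclideanSpace ℝ (Fin k)))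
    set c : ℝ := ((2 * Real.pi) ^ ((k : ℝ) / 2))⁻¹
    have hc : 0 ≤ c := by positivity
    refine ⟨∫ r : Set.Ioi (0 : ℝ), c * Real.exp (-(1 / 2) * (r : ℝ) ^ 2)
      ∂(Measure.volumeIoiPow (Module.finrank ℝ (EuclideanSpace ℝ (Fin k)) - 1)), fun f => ?_⟩
    rw [stdGaussian_eq_withDensity, integral_withDensity_eq_integral_toReal_smul
      (by fun_prop) (by simp)]
    have e := integral_subtype_comap (μ := μ)
      (measurableSet_singleton (0 : EuclideanSpace ℝ (Fin k))).compl
      (fun x => (ENNReal.ofReal (c * Real.exp (-(1 / 2) * ‖x‖ ^ 2))).toReal •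
        radialExtension f x)
    rw [restrict_compl_singleton] at e
    refine e.symm.trans ?_
    have := μ.measurePreserving_homeomorphUnitSphereProd.integral_comp
        (Homeomorph.measurableEmbedding _)
        (fun p => f p.1 * (c * Real.exp (-(1 / 2) * (p.2 : ℝ) ^ 2)))
    rw [integral_prod_mul f (fun r : Set.Ioi (0 : ℝ) => c * Real.exp (-(1 / 2) * (r : ℝ) ^ 2)),
      mul_comm] at this
    rw [← this]
    refine integral_congr_ae (Eventually.of_forall fun x => ?_)
    dsimp only
    have hx : (x : EuclideanSpace ℝ (Fin k)) ≠ 0 := x.2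
    rw [ENNReal.toReal_ofReal (by positivity), smul_eq_mul, mul_comm, radialExtension,
      dif_neg hx]
    congr 2
    · congr 1
      ext1
      simp
    · simp
  have h1 := hA fun _ => 1
  have hae : ∀ᵐ g ∂(stdGaussian (EuclideanSpace ℝ (Fin k))),
      radialExtension (fun _ : UnitSphere k => (1 : ℝ)) g = 1 := by
    have : ∀ᵐ g ∂(stdGaussian (EuclideanSpace ℝ (Fin k))), g ≠ 0 := by
      rw [stdGaussian_eq_withDensity]
      exact (withDensity_absolutelyContinuous _ _).ae_le (Measure.ae_ne volume 0)
    filter_upwards [this] with g hg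
    simp [radialExtension, hg]
  rw [integral_congr_ae hae] at h1
  simp only [integral_const, probReal_univ, smul_eq_mul, mul_one] at h1
  rw [hA f, uniformSphere, integral_smul_measure, ENNReal.toReal_inv, smul_eq_mul]
  congr 1
  exact (eq_inv_of_mul_eq_one_left h1.symm).symm

/-- The action of a linear isometry of the ambient space on the unit sphere. -/
noncomputable def rotateSphere {k : ℕ} (R : EuclideanSpace ℝ (Fin k) ≃ₗᵢ[ℝ] EuclideanSpace ℝ (Fin k))
    (x : UnitSphere k) : UnitSphere k :=
  ⟨R x, by rw [mem_sphere_zero_iff_norm, R.norm_map]; simp⟩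

lemma radialExtension_comp_rotateSphere {k : ℕ}
    (R : EuclideanSpace ℝ (Fin k) ≃ₗᵢ[ℝ] EuclideanSpace ℝ (Fin k)) (f : UnitSphere k → ℝ) :
    radialExtension (fun x => f (rotateSphere R x)) = radialExtension f ∘ R := by
  ext y
  by_cases hy : y = 0
  · simp [radialExtension, hy]
  · have hy' : R y ≠ 0 := by simpa using hy
    simp [radialExtension, hy, hy', rotateSphere]

lemma integral_comp_rotateSphere {k : ℕ} [NeZero k]
    (R : EuclideanSpace ℝ (Fin k) ≃ₗᵢ[ℝ] EuclideanSpace ℝ (Fin k)) (f : UnitSphere k → ℝ) :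
    ∫ x, f (rotateSphere R x) ∂(uniformSphere k) = ∫ x, f x ∂(uniformSphere k) := by
  rw [integral_uniformSphere_eq_stdGaussian, integral_uniformSphere_eq_stdGaussian,
    radialExtension_comp_rotateSphere]
  have := R.toHomeomorph.measurableEmbedding.integral_map
    (μ := stdGaussian (EuclideanSpace ℝ (Fin k))) (radialExtension f)
  have h2 := stdGaussian_map R
  simp only [LinearIsometryEquiv.coe_toHomeomorph] at this
  rw [h2] at this
  rw [this]
  rfl

lemma map_inner_stdGaussian {n : ℕ} {a : EuclideanSpace ℝ (Fin n)} (ha : ‖a‖ = 1) :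
    (stdGaussian (EuclideanSpace ℝ (Fin n))).map (fun g => inner ℝ a g) = gaussianReal 0 1 := by
  refine Measure.ext_of_charFun ?_
  ext t
  rw [charFun_gaussianReal, charFun_apply, integral_map (by fun_prop) (by fun_prop)]
  have := charFun_stdGaussian (E := EuclideanSpace ℝ (Fin n)) (t • a)
  rw [charFun_apply] at this
  simp only [inner_smul_right, norm_smul, ha, real_inner_comm] at this ⊢
  simp only [RCLike.inner_apply, conj_trivial]
  convert this using 2
  · ext x
    rw [real_inner_comm, mul_comm t]
  · rw [mul_one, Real.norm_eq_abs, ← Complex.ofReal_pow |t|, sq_abs]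
    simp [neg_div]

/-- The coordinates of a standard Gaussian vector along two orthonormal vectors are independent
standard Gaussian variables. -/
lemma map_inner_prodMk_stdGaussian {n : ℕ} {a c : EuclideanSpace ℝ (Fin n)} (ha : ‖a‖ = 1)
    (hc : ‖c‖ = 1) (hac : inner ℝ a c = 0) :
    (stdGaussian (EuclideanSpace ℝ (Fin n))).map (fun g => (inner ℝ a g, inner ℝ c g)) =
      (gaussianReal 0 1).prod (gaussianReal 0 1) := by
  have hL : HasGaussianLaw (fun g : EuclideanSpace ℝ (Fin n) => (inner ℝ a g, inner ℝ c g))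
      (stdGaussian (EuclideanSpace ℝ (Fin n))) := by
    simpa using (IsGaussian.hasGaussianLaw_id
      (μ := stdGaussian (EuclideanSpace ℝ (Fin n)))).map_fun
      ((innerSL ℝ a).prod (innerSL ℝ c))
  have hI : IndepFun (fun g => inner ℝ a g) (fun g => inner ℝ c g)
      (stdGaussian (EuclideanSpace ℝ (Fin n))) := by
    refine hL.indepFun_of_covariance_eq_zero ?_
    rw [← covarianceBilin_apply_eq_cov IsGaussian.memLp_two_id, covarianceBilin_stdGaussian]
    exact hac
  rw [(indepFun_iff_map_prod_eq_prod_map_map (by fun_prop) (by fun_prop)).1 hI,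
    map_inner_stdGaussian ha, map_inner_stdGaussian hc]

/-- The squared norm of a standard Gaussian vector is a sum of `n` independent squares, so its
relative fluctuations are of order `n ^ (-1/2)`. -/
lemma exists_integral_normSq_sub_one_sq_stdGaussian : ∃ v : ℝ, 0 ≤ v ∧ ∀ n : ℕ, n ≠ 0 →
    Integrable (fun g => (‖g‖ ^ 2 / n - 1) ^ 2) (stdGaussian (EuclideanSpace ℝ (Fin n))) ∧
    ∫ g, (‖g‖ ^ 2 / n - 1) ^ 2 ∂(stdGaussian (EuclideanSpace ℝ (Fin n))) = v / n := by
  refine ⟨Var[fun x => x ^ 2; gaussianReal 0 1], variance_nonneg _ _, fun n hn => ?_⟩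
  have hn' : (n : ℝ) ≠ 0 := by exact_mod_cast hn
  set P := Measure.pi (fun _ : Fin n => gaussianReal 0 1)
  have h2 : MemLp (fun x : ℝ => x ^ 2) 2 (gaussianReal 0 1) := by
    have h4 := memLp_id_gaussianReal (μ := 0) (v := 1) 4
    rw [memLp_two_iff_integrable_sq (by fun_prop)]
    have := h4.integrable_norm_pow (by norm_num)
    refine this.congr (Eventually.of_forall fun x => ?_)
    simp only [id, Real.norm_eq_abs, ← pow_mul]
    exact Even.pow_abs (by decide) x
  have hsq : ∫ x, x ^ 2 ∂(gaussianReal 0 1) = 1 := by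
    have := variance_fun_id_gaussianReal (μ := 0) (v := 1)
    rw [variance_eq_integral (by fun_prop)] at this
    simpa using this
  have hvar := variance_sum_pi (μ := fun _ : Fin n => gaussianReal 0 1)
    (X := fun _ x => x ^ 2) (fun _ => h2)
  have hmemi : ∀ i : Fin n, MemLp (fun w : Fin n → ℝ => w i ^ 2) 2 P := fun i =>
    h2.comp_measurePreserving (measurePreserving_eval (fun _ : Fin n => gaussianReal 0 1) i)
  have hmem : MemLp (∑ i : Fin n, fun w : Fin n → ℝ => w i ^ 2) 2 P :=
    memLp_finsetSum' _ fun i _ => hmemi i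
  have hmean : ∫ w, (∑ i : Fin n, fun w : Fin n → ℝ => w i ^ 2) w ∂P = n := by
    simp only [Finset.sum_apply]
    rw [integral_finsetSum _ fun i _ => (hmemi i).integrable (by norm_num)]
    have : ∀ i : Fin n, ∫ w, w i ^ 2 ∂P = 1 := fun i => by
      rw [integral_comp_eval (μ := fun _ : Fin n => gaussianReal 0 1)
        (f := fun x : ℝ => x ^ 2) (by fun_prop), hsq]
    simp [this]
  rw [variance_eq_integral (by fun_prop), hmean] at hvar
  have hint := (hmem.sub (memLp_const (n : ℝ))).integrable_sq
  have hnorm : ∀ w : Fin n → ℝ, (‖WithLp.toLp 2 w‖ ^ 2 / n - 1) ^ 2 =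
      ((∑ i : Fin n, fun w : Fin n → ℝ => w i ^ 2) w - n) ^ 2 / n ^ 2 := by
    intro w
    rw [EuclideanSpace.real_norm_sq_eq]
    simp only [Finset.sum_apply]
    field_simp
  rw [← map_pi_eq_stdGaussian]
  constructor
  · rw [integrable_map_measure (by fun_prop) (by fun_prop)]
    simp only [Function.comp_def, hnorm]
    exact hint.div_const _
  · rw [integral_map (by fun_prop) (by fun_prop)]
    simp only [hnorm]
    rw [integral_div, hvar]
    simp only [Finset.sum_const, Finset.card_univ, Fintype.card_fin, nsmul_eq_mul]
    field_simp

/-! ### Estimates for the standard normal distribution -/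

/-- The distribution function of the standard normal distribution. -/
noncomputable def normalCDF (u : ℝ) : ℝ := (gaussianReal 0 1).real (Set.Iic u)

/-- The density of the standard normal distribution. -/
noncomputable def normalPDF (u : ℝ) : ℝ := gaussianPDFReal 0 1 u

lemma normalPDF_eq (x : ℝ) :
    normalPDF x = (√(2 * Real.pi))⁻¹ * Real.exp (-x ^ 2 / 2) := by
  simp [normalPDF, gaussianPDFReal]

lemma normalPDF_nonneg (x : ℝ) : 0 ≤ normalPDF x := gaussianPDFReal_nonneg _ _ _

lemma hasDerivAt_normalPDF (x : ℝ) : HasDerivAt normalPDF (-x * normalPDF x) x := by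
  have h : HasDerivAt (fun x : ℝ => (√(2 * Real.pi))⁻¹ * Real.exp (-x ^ 2 / 2))
      ((√(2 * Real.pi))⁻¹ * (Real.exp (-x ^ 2 / 2) * (-(2 * x) / 2))) x := by
    have := (((hasDerivAt_pow 2 x).neg.div_const 2).exp).const_mul (√(2 * Real.pi))⁻¹
    simpa using this
  rw [show normalPDF = _ from funext normalPDF_eq]
  convert h using 1
  ring

lemma continuous_normalPDF : Continuous normalPDF :=
  continuous_iff_continuousAt.2 fun x => (hasDerivAt_normalPDF x).continuousAt

lemma normalPDF_mul_le (x : ℝ) : (1 + x ^ 2 / 2) * normalPDF x ≤ 1 / 2 := by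
  rw [normalPDF_eq]
  have h1 : (2 : ℝ) ≤ √(2 * Real.pi) := by
    apply Real.le_sqrt_of_sq_le
    nlinarith [Real.pi_gt_three]
  have h2 : (√(2 * Real.pi))⁻¹ ≤ 1 / 2 := by
    rw [one_div]
    exact inv_anti₀ (by norm_num) h1
  have h3 : (1 + x ^ 2 / 2) * Real.exp (-x ^ 2 / 2) ≤ 1 := by
    have h4 := Real.add_one_le_exp (x ^ 2 / 2)
    calc (1 + x ^ 2 / 2) * Real.exp (-x ^ 2 / 2)
        ≤ Real.exp (x ^ 2 / 2) * Real.exp (-x ^ 2 / 2) := by gcongr; linarith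
      _ = 1 := by rw [← Real.exp_add]; simp [neg_div]
  have h5 : 0 ≤ (1 + x ^ 2 / 2) * Real.exp (-x ^ 2 / 2) := by positivity
  calc _ = (√(2 * Real.pi))⁻¹ * ((1 + x ^ 2 / 2) * Real.exp (-x ^ 2 / 2)) := by ring
    _ ≤ 1 / 2 * 1 := by gcongr
    _ = _ := by norm_num

lemma normalPDF_le_one (x : ℝ) : normalPDF x ≤ 1 := by
  nlinarith [normalPDF_mul_le x, normalPDF_nonneg x, mul_nonneg (sq_nonneg x) (normalPDF_nonneg x)]

lemma sq_mul_normalPDF_le (x : ℝ) : x ^ 2 * normalPDF x ≤ 1 := by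
  nlinarith [normalPDF_mul_le x, normalPDF_nonneg x]

lemma abs_mul_normalPDF_le (x : ℝ) : |x| * normalPDF x ≤ 1 := by
  have h : |x| ≤ 1 + x ^ 2 / 2 := by
    rw [← sq_abs]; nlinarith [sq_nonneg (|x| - 1)]
  nlinarith [normalPDF_mul_le x, mul_le_mul_of_nonneg_right h (normalPDF_nonneg x)]

lemma normalCDF_nonneg (u : ℝ) : 0 ≤ normalCDF u := measureReal_nonneg

lemma normalCDF_le_one (u : ℝ) : normalCDF u ≤ 1 := measureReal_le_one

lemma normalCDF_eq_integral (u : ℝ) : normalCDF u = ∫ x in Set.Iic u, normalPDF x := by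
  rw [normalCDF, measureReal_def, gaussianReal_apply_eq_integral _ one_ne_zero,
    ENNReal.toReal_ofReal]
  · rfl
  · exact integral_nonneg fun x => normalPDF_nonneg x

lemma integrable_normalPDF : Integrable normalPDF := integrable_gaussianPDFReal 0 1

lemma hasDerivAt_normalCDF (u : ℝ) : HasDerivAt normalCDF (normalPDF u) u := by
  have h : ∀ v, normalCDF v = (∫ x in (0 : ℝ)..v, normalPDF x) + normalCDF 0 := by
    intro v
    rw [normalCDF_eq_integral, normalCDF_eq_integral, ← sub_eq_iff_eq_add]
    exact intervalIntegral.integral_Iic_sub_Iic integrable_normalPDF.integrableOn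
      integrable_normalPDF.integrableOn
  rw [show normalCDF = _ from funext h]
  exact (intervalIntegral.integral_hasDerivAt_right
    (continuous_normalPDF.intervalIntegrable _ _)
    (continuous_normalPDF.stronglyMeasurableAtFilter _ _)
    continuous_normalPDF.continuousAt).add_const _

lemma continuous_normalCDF : Continuous normalCDF :=
  continuous_iff_continuousAt.2 fun x => (hasDerivAt_normalCDF x).continuousAt

lemma monotone_normalCDF : Monotone normalCDF := fun _ _ h =>
  measureReal_mono (Set.Iic_subset_Iic.2 h)

/-- Rescaling the argument by `r` perturbs the normal distribution function by at most a multiple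
of `|r - 1|`, uniformly in the argument. -/
lemma abs_normalCDF_mul_sub_le (u r : ℝ) :
    |normalCDF (u * r) - normalCDF u| ≤ 2 * |r - 1| := by
  rcases lt_or_ge r (1 / 2) with h | h
  · have h1 : |normalCDF (u * r) - normalCDF u| ≤ 1 := by
      rw [abs_le]
      constructor <;> linarith [normalCDF_nonneg u, normalCDF_le_one u, normalCDF_nonneg (u * r),
        normalCDF_le_one (u * r)]
    rw [abs_of_neg (by linarith : r - 1 < 0)]
    linarith
  · have hd : ∀ s ∈ Set.Ici (1 / 2 : ℝ), HasDerivWithinAt (fun s => normalCDF (u * s))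
        (normalPDF (u * s) * u) (Set.Ici (1 / 2)) s := by
      intro s _
      have : HasDerivAt (fun s => normalCDF (u * s)) (normalPDF (u * s) * (u * 1)) s :=
        (hasDerivAt_normalCDF (u * s)).comp s ((hasDerivAt_id s).const_mul u)
      simpa using this.hasDerivWithinAt
    have := (convex_Ici (1 / 2 : ℝ)).norm_image_sub_le_of_norm_hasDerivWithin_le (C := 2) hd
      (fun s hs => ?_) (x := 1) (y := r) (by simp; norm_num) h
    · simpa using this
    · rw [Set.mem_Ici] at hs
      rw [Real.norm_eq_abs, abs_mul, abs_of_nonneg (normalPDF_nonneg _)]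
      have h1 := abs_mul_normalPDF_le (u * s)
      rw [abs_mul, abs_of_nonneg (by linarith : (0 : ℝ) ≤ s)] at h1
      have h2 := mul_nonneg (abs_nonneg u) (normalPDF_nonneg (u * s))
      nlinarith

lemma abs_normalPDF_sub_le (x y : ℝ) : |normalPDF y - normalPDF x| ≤ |y - x| := by
  have := convex_univ.norm_image_sub_le_of_norm_hasDerivWithin_le (C := 1)
    (fun s _ => (hasDerivAt_normalPDF s).hasDerivWithinAt) (fun s _ => ?_)
    (Set.mem_univ x) (Set.mem_univ y)
  · simpa using this
  · rw [Real.norm_eq_abs, abs_mul, abs_neg, abs_of_nonneg (normalPDF_nonneg _)]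
    exact abs_mul_normalPDF_le s

lemma normalCDF_add_le (v h : ℝ) :
    normalCDF (v + h) ≤ normalCDF v + h * normalPDF v + h ^ 2 := by
  have hd : ∀ s ∈ Set.uIcc 0 h, HasDerivWithinAt (fun s => normalCDF (v + s) - s * normalPDF v)
      (normalPDF (v + s) - normalPDF v) (Set.uIcc 0 h) s := by
    intro s _
    have h1 : HasDerivAt (fun s => normalCDF (v + s)) (normalPDF (v + s) * 1) s :=
      (hasDerivAt_normalCDF (v + s)).comp s ((hasDerivAt_id s).const_add v)
    have h2 : HasDerivAt (fun s => s * normalPDF v) (1 * normalPDF v) s :=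
      (hasDerivAt_id s).mul_const (normalPDF v)
    simpa using (h1.fun_sub h2).hasDerivWithinAt
  have := (convex_uIcc 0 h).norm_image_sub_le_of_norm_hasDerivWithin_le (C := |h|) hd
    (fun s hs => ?_) Set.left_mem_uIcc Set.right_mem_uIcc
  · simp only [add_zero, zero_mul, sub_zero, Real.norm_eq_abs, abs_mul_abs_self] at this
    have := le_of_abs_le this
    nlinarith
  · rw [Real.norm_eq_abs]
    refine (abs_normalPDF_sub_le v (v + s)).trans ?_
    have := Set.abs_sub_left_of_mem_uIcc hs
    simpa using this

lemma abs_mul_normalPDF_mul_sub_le (u s : ℝ) :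
    |s * normalPDF (u * s) - normalPDF u| ≤ 2 * |s - 1| := by
  have hd : ∀ s ∈ (Set.univ : Set ℝ), HasDerivWithinAt (fun s => s * normalPDF (u * s))
      (1 * normalPDF (u * s) + s * (-(u * s) * normalPDF (u * s) * u)) Set.univ s := by
    intro s _
    have h1 : HasDerivAt (fun s => normalPDF (u * s))
        (-(u * s) * normalPDF (u * s) * (u * 1)) s :=
      (hasDerivAt_normalPDF (u * s)).comp s ((hasDerivAt_id s).const_mul u)
    rw [mul_one] at h1
    exact ((hasDerivAt_id s).fun_mul h1).hasDerivWithinAt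
  have := convex_univ.norm_image_sub_le_of_norm_hasDerivWithin_le (C := 2)
    hd (fun s _ => ?_) (Set.mem_univ 1) (Set.mem_univ s)
  · simpa using this
  · have h1 := sq_mul_normalPDF_le (u * s)
    have h2 := normalPDF_le_one (u * s)
    have h3 := normalPDF_nonneg (u * s)
    have h4 := mul_nonneg (sq_nonneg (u * s)) h3
    rw [Real.norm_eq_abs, abs_le]
    constructor <;> nlinarith

lemma integrable_mul_normalPDF : Integrable fun t => t * normalPDF t := by
  have := (integrable_mul_exp_neg_mul_sq (b := 1 / 2) (by norm_num)).const_mul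
    (√(2 * Real.pi))⁻¹
  refine this.congr (Eventually.of_forall fun t => ?_)
  simp only [normalPDF_eq]
  ring_nf

lemma integral_Iic_mul_normalPDF (u : ℝ) :
    ∫ t in Set.Iic u, t * normalPDF t = -normalPDF u := by
  have hd : ∀ x ∈ Set.Iic u, HasDerivAt (fun t => -normalPDF t) (x * normalPDF x) x := by
    intro x _
    simpa using (hasDerivAt_normalPDF x).fun_neg
  have hi := integrable_mul_normalPDF.integrableOn (s := Set.Iic u)
  have := integral_Iic_of_hasDerivAt_of_tendsto' hd hi
    (tendsto_zero_of_hasDerivAt_of_integrableOn_Iic hd hi integrable_normalPDF.neg.integrableOn)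
  simpa using this

lemma setIntegral_Iic_id_gaussianReal (u : ℝ) :
    ∫ t in Set.Iic u, t ∂(gaussianReal 0 1) = -normalPDF u := by
  rw [← integral_Iic_mul_normalPDF, gaussianReal_of_var_ne_zero _ one_ne_zero,
    setIntegral_withDensity_eq_setIntegral_toReal_smul (measurable_gaussianPDF 0 1)
      (Eventually.of_forall fun _ => gaussianPDF_lt_top) _ measurableSet_Iic]
  refine integral_congr_ae (Eventually.of_forall fun t => ?_)
  simp [normalPDF, mul_comm]

lemma integrable_id_gaussianReal : Integrable (fun t : ℝ => t) (gaussianReal 0 1) :=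
  (memLp_id_gaussianReal (μ := 0) (v := 1) 1).integrable (by simp)

lemma integrable_sq_gaussianReal : Integrable (fun t : ℝ => t ^ 2) (gaussianReal 0 1) :=
  (memLp_id_gaussianReal (μ := 0) (v := 1) 2).integrable_sq

lemma integral_sq_gaussianReal : ∫ t, t ^ 2 ∂(gaussianReal 0 1) = 1 := by
  have := variance_fun_id_gaussianReal (μ := 0) (v := 1)
  rw [variance_eq_integral (by fun_prop)] at this
  simpa using this

lemma measurableSet_quadrant (u ρ σ : ℝ) :
    MeasurableSet {p : ℝ × ℝ | p.1 ≤ u ∧ ρ * p.1 + σ * p.2 ≤ u} :=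
  MeasurableSet.inter (s₁ := {p : ℝ × ℝ | p.1 ≤ u}) (s₂ := {p : ℝ × ℝ | ρ * p.1 + σ * p.2 ≤ u})
    (measurableSet_le (by fun_prop) (by fun_prop)) (measurableSet_le (by fun_prop) (by fun_prop))

/-- The distribution function of `(t, ρ t + σ w)` for independent standard Gaussian `t`, `w`, as an
integral over `t`. -/
lemma prod_gaussianReal_quadrant (u ρ : ℝ) {σ : ℝ} (hσ : 0 < σ) :
    ((gaussianReal 0 1).prod (gaussianReal 0 1)).real
      {p : ℝ × ℝ | p.1 ≤ u ∧ ρ * p.1 + σ * p.2 ≤ u} =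
      ∫ t in Set.Iic u, normalCDF ((u - ρ * t) * σ⁻¹) ∂(gaussianReal 0 1) := by
  have hm := measurableSet_quadrant u ρ σ
  rw [measureReal_def, Measure.prod_apply hm, ← integral_toReal
    (measurable_measure_prodMk_left hm).aemeasurable (by simp),
    ← integral_indicator measurableSet_Iic]
  refine integral_congr_ae (Eventually.of_forall fun t => ?_)
  by_cases ht : t ≤ u
  · simp only [Set.preimage_ofPred_eq, ht, true_and, Set.indicator, Set.mem_Iic, if_true,
      normalCDF, measureReal_def]
    congr 2
    ext w
    simp only [Set.mem_ofPred_eq, Set.mem_Iic, ← div_eq_mul_inv]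
    rw [le_div_iff₀ hσ]
    constructor <;> intro h <;> linarith
  · simp [ht]

/-- The orthant probability of a pair of standard Gaussian variables with small correlation `ρ`,
expanded to first order in `ρ`. -/
lemma prod_gaussianReal_quadrant_le (u : ℝ) {ρ σ : ℝ} (hρ : |ρ| ≤ 1 / 2) (hσ : 0 < σ)
    (h1 : ρ ^ 2 + σ ^ 2 = 1) :
    ((gaussianReal 0 1).prod (gaussianReal 0 1)).real
      {p : ℝ × ℝ | p.1 ≤ u ∧ ρ * p.1 + σ * p.2 ≤ u} ≤
      normalCDF u ^ 2 + ρ * normalPDF u ^ 2 + 8 * ρ ^ 2 := by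
  rw [prod_gaussianReal_quadrant u ρ hσ]
  set s := σ⁻¹ with hs
  have hρ2 : ρ ^ 2 ≤ 1 / 4 := by
    rw [← sq_abs]; nlinarith [abs_nonneg ρ]
  have hσs : σ * s = 1 := mul_inv_cancel₀ hσ.ne'
  have hs0 : 0 < s := inv_pos.2 hσ
  have hσ1 : σ ≤ 1 := by nlinarith [sq_nonneg ρ]
  have hs1 : 1 ≤ s := by nlinarith
  -- `s = (1 - ρ²)^(-1/2) ≤ 1 + ρ²` because `(1 + q)² (1 - q) ≥ 1` for `0 ≤ q ≤ 1 / 2`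
  have hs2 : s ≤ 1 + ρ ^ 2 := by
    have h3 : 1 ≤ (1 + ρ ^ 2) * σ := by
      have : 1 ≤ ((1 + ρ ^ 2) * σ) ^ 2 := by
        rw [mul_pow, show σ ^ 2 = 1 - ρ ^ 2 by linarith]
        have : 0 ≤ ρ ^ 2 := sq_nonneg ρ
        nlinarith [mul_nonneg this this, mul_nonneg this (mul_nonneg this this)]
      nlinarith [mul_nonneg (by positivity : 0 ≤ 1 + ρ ^ 2) hσ.le]
    nlinarith
  have hpt : ∀ t, normalCDF ((u - ρ * t) * s) ≤
      normalCDF (u * s) - ρ * (s * normalPDF (u * s)) * t + 4 * ρ ^ 2 * t ^ 2 := by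
    intro t
    have := normalCDF_add_le (u * s) (-(ρ * t * s))
    have h4 : s ^ 2 ≤ 4 := by nlinarith
    have h5 : (ρ * t * s) ^ 2 ≤ 4 * ρ ^ 2 * t ^ 2 := by
      nlinarith [mul_le_mul_of_nonneg_left h4 (sq_nonneg (ρ * t))]
    rw [show (u - ρ * t) * s = u * s + -(ρ * t * s) by ring]
    nlinarith
  have hi1 : Integrable (fun t => normalCDF ((u - ρ * t) * s)) (gaussianReal 0 1) := by
    refine Integrable.of_bound (C := 1) ?_ (Eventually.of_forall fun t => ?_)
    · exact (continuous_normalCDF.comp (by fun_prop)).aestronglyMeasurable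
    · rw [Real.norm_of_nonneg (normalCDF_nonneg _)]
      exact normalCDF_le_one _
  have hic : Integrable (fun t : ℝ => normalCDF (u * s) - ρ * (s * normalPDF (u * s)) * t)
      (gaussianReal 0 1) :=
    (integrable_const _).sub (integrable_id_gaussianReal.const_mul _)
  have hi2 : Integrable (fun t => 4 * ρ ^ 2 * t ^ 2) (gaussianReal 0 1) :=
    integrable_sq_gaussianReal.const_mul _
  have hi3 : Integrable (fun t => normalCDF (u * s) - ρ * (s * normalPDF (u * s)) * t +
      4 * ρ ^ 2 * t ^ 2) (gaussianReal 0 1) := hic.add hi2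
  have hle := integral_mono_measure (μ := (gaussianReal 0 1).restrict (Set.Iic u))
    (ν := gaussianReal 0 1) Measure.restrict_le_self
    (Eventually.of_forall fun t => by positivity) hi2
  rw [integral_const_mul (4 * ρ ^ 2) (fun t : ℝ => t ^ 2) (μ := gaussianReal 0 1),
    integral_sq_gaussianReal] at hle
  have hkey : ∫ t in Set.Iic u, normalCDF ((u - ρ * t) * s) ∂(gaussianReal 0 1) ≤
      normalCDF (u * s) * normalCDF u + ρ * (s * normalPDF (u * s)) * normalPDF u
        + 4 * ρ ^ 2 := by
    calc _ ≤ ∫ t in Set.Iic u, (normalCDF (u * s) - ρ * (s * normalPDF (u * s)) * t +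
          4 * ρ ^ 2 * t ^ 2) ∂(gaussianReal 0 1) :=
          integral_mono hi1.integrableOn hi3.integrableOn hpt
      _ = (normalCDF (u * s) * normalCDF u + ρ * (s * normalPDF (u * s)) * normalPDF u)
          + ∫ t in Set.Iic u, 4 * ρ ^ 2 * t ^ 2 ∂(gaussianReal 0 1) := by
          rw [integral_add hic.integrableOn hi2.integrableOn,
            integral_sub (integrable_const _) (integrable_id_gaussianReal.const_mul _).integrableOn,
            integral_const_mul, setIntegral_Iic_id_gaussianReal]
          simp [normalCDF, mul_comm]
      _ ≤ _ := by linarith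
  have hA := le_of_abs_le (abs_normalCDF_mul_sub_le u s)
  have hB := abs_mul_normalPDF_mul_sub_le u s
  rw [abs_of_nonneg (by linarith : 0 ≤ s - 1)] at hA hB
  have hφ0 := normalPDF_nonneg u
  have hφ1 := normalPDF_le_one u
  have hΦ0 := normalCDF_nonneg u
  have hΦ1 := normalCDF_le_one u
  have hC : ρ * (s * normalPDF (u * s) - normalPDF u) * normalPDF u ≤ 2 * ρ ^ 2 := by
    refine (le_abs_self _).trans ?_
    rw [abs_mul, abs_mul, abs_of_nonneg hφ0]
    calc |ρ| * |s * normalPDF (u * s) - normalPDF u| * normalPDF u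
        ≤ 1 * (2 * ρ ^ 2) * 1 := by
          gcongr
          · linarith
          · linarith
      _ = _ := by ring
  have hD : (normalCDF (u * s) - normalCDF u) * normalCDF u ≤ 2 * ρ ^ 2 := by
    calc (normalCDF (u * s) - normalCDF u) * normalCDF u
        ≤ (2 * ρ ^ 2) * normalCDF u := by gcongr; linarith
      _ ≤ (2 * ρ ^ 2) * 1 := by gcongr
      _ = _ := by ring
  nlinarith

/-- For unit vectors `a`, `b`, the Gaussian variables `⟪a, g⟫` and `⟪b, g⟫` have correlation
`⟪a, b⟫`, and the probability that both are at most `u` exceeds the value for independent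
variables by at most a linear term, with nonnegative coefficient, and a quadratic term in the
correlation. -/
theorem stdGaussian_quadrant_le {n : ℕ} {a b : EuclideanSpace ℝ (Fin n)} (ha : ‖a‖ = 1)
    (hb : ‖b‖ = 1) (u : ℝ) :
    (stdGaussian (EuclideanSpace ℝ (Fin n))).real {g | inner ℝ a g ≤ u ∧ inner ℝ b g ≤ u} ≤
      normalCDF u ^ 2 + inner ℝ a b * normalPDF u ^ 2 + 8 * (inner ℝ a b) ^ 2 := by
  set ρ : ℝ := inner ℝ a b with hρdef
  rcases le_or_gt |ρ| (1 / 2) with h | h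
  · have hρ2 : ρ ^ 2 ≤ 1 / 4 := by
      rw [← sq_abs]; nlinarith [abs_nonneg ρ]
    set σ : ℝ := √(1 - ρ ^ 2)
    have hσ : 0 < σ := Real.sqrt_pos.2 (by linarith)
    have hσ2 : σ ^ 2 = 1 - ρ ^ 2 := Real.sq_sqrt (by linarith)
    set c := σ⁻¹ • (b - ρ • a) with hc
    have hbc : b = ρ • a + σ • c := by
      rw [hc, smul_smul, mul_inv_cancel₀ hσ.ne', one_smul]; abel
    have hac : inner ℝ a c = 0 := by
      rw [hc, inner_smul_right, inner_sub_right, inner_smul_right, real_inner_self_eq_norm_sq, ha]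
      simp [hρdef]
    have hc1 : ‖c‖ = 1 := by
      have h2 : ‖b - ρ • a‖ ^ 2 = σ ^ 2 := by
        rw [norm_sub_sq_real, inner_smul_right, norm_smul, ha, hb, real_inner_comm, hσ2,
          mul_one, Real.norm_eq_abs, sq_abs, ← hρdef]
        ring
      have h3 : ‖b - ρ • a‖ = σ := by
        rwa [sq_eq_sq₀ (norm_nonneg _) hσ.le] at h2
      rw [hc, norm_smul, h3, norm_inv, Real.norm_of_nonneg hσ.le, inv_mul_cancel₀ hσ.ne']
    have hset : {g : EuclideanSpace ℝ (Fin n) | inner ℝ a g ≤ u ∧ inner ℝ b g ≤ u} =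
        (fun g => ((inner ℝ a g : ℝ), (inner ℝ c g : ℝ))) ⁻¹'
          {p : ℝ × ℝ | p.1 ≤ u ∧ ρ * p.1 + σ * p.2 ≤ u} := by
      ext g
      simp only [Set.mem_ofPred_eq, Set.preimage_ofPred_eq]
      conv_lhs => rw [hbc]
      rw [inner_add_left, real_inner_smul_left, real_inner_smul_left]
    rw [hset, ← map_measureReal_apply (by fun_prop) (measurableSet_quadrant u ρ σ),
      map_inner_prodMk_stdGaussian ha hc1 hac]
    exact prod_gaussianReal_quadrant_le u h hσ (by linarith)
  · have h1 : |ρ| ≤ 1 := by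
      simpa [ha, hb] using abs_real_inner_le_norm a b
    have h2 : 1 / 4 ≤ ρ ^ 2 := by rw [← sq_abs]; nlinarith
    have h3 : -1 ≤ ρ * normalPDF u ^ 2 := by
      have := neg_le_of_abs_le h1
      nlinarith [normalPDF_le_one u, normalPDF_nonneg u,
        mul_nonneg (normalPDF_nonneg u) (sub_nonneg.2 (normalPDF_le_one u)),
        sq_nonneg (normalPDF u)]
    have h4 : (stdGaussian (EuclideanSpace ℝ (Fin n))).real
      {g | inner ℝ a g ≤ u ∧ inner ℝ b g ≤ u} ≤ 1 := measureReal_le_one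
    nlinarith [sq_nonneg (normalCDF u)]

/-! ### Rotation invariance and the addition theorem -/

lemma laplacian_comp_linearIsometryEquiv {k : ℕ}
    (R : EuclideanSpace ℝ (Fin k) ≃ₗᵢ[ℝ] EuclideanSpace ℝ (Fin k))
    (F : EuclideanSpace ℝ (Fin k) → ℝ) (x : EuclideanSpace ℝ (Fin k)) :
    Δ (F ∘ R) x = Δ F (R x) := by
  set v := EuclideanSpace.basisFun (Fin k) ℝ
  rw [InnerProductSpace.laplacian_eq_iteratedFDeriv_orthonormalBasis _ v,
    InnerProductSpace.laplacian_eq_iteratedFDeriv_orthonormalBasis _ (v.map R)]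
  refine Finset.sum_congr rfl fun i _ => ?_
  have h := R.toContinuousLinearEquiv.iteratedFDerivWithin_comp_right F uniqueDiffOn_univ
    (x := x) (Set.mem_univ _) 2
  simp only [Set.preimage_univ, iteratedFDerivWithin_univ] at h
  have h2 : (F ∘ R) = F ∘ R.toContinuousLinearEquiv := rfl
  rw [h2, h]
  simp only [ContinuousMultilinearMap.compContinuousLinearMap_apply]
  congr 1
  ext j
  fin_cases j <;> rfl

lemma IsSphericalHarmonic.comp_rotateSphere {d ℓ : ℕ} {f : UnitSphere (d + 1) → ℝ}
    (hf : IsSphericalHarmonic d ℓ f)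
    (R : EuclideanSpace ℝ (Fin (d + 1)) ≃ₗᵢ[ℝ] EuclideanSpace ℝ (Fin (d + 1))) :
    IsSphericalHarmonic d ℓ (fun x => f (rotateSphere R x)) := by
  constructor
  · rw [SmoothOnSphere, radialExtension_comp_rotateSphere]
    exact hf.1.comp R.contDiff.contDiffOn fun x hx => by simpa using hx
  · intro x
    rw [sphereLaplacian, radialExtension_comp_rotateSphere, laplacian_comp_linearIsometryEquiv]
    exact hf.2 (rotateSphere R x)

lemma SmoothOnSphere.continuous {k : ℕ} {f : UnitSphere k → ℝ} (hf : SmoothOnSphere f) :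
    Continuous f := by
  have h : f = fun x : UnitSphere k => radialExtension f (x : EuclideanSpace ℝ (Fin k)) := by
    ext x; rw [radialExtension_coe]
  rw [h]
  refine hf.continuousOn.comp_continuous continuous_subtype_val fun x => ?_
  have : ‖(x : EuclideanSpace ℝ (Fin k))‖ = 1 := by simp
  simp only [Set.mem_compl_iff, Set.mem_singleton_iff]
  rintro h0
  simp [h0] at this

lemma integrable_of_continuous_sphere {k : ℕ} [NeZero k] {f : UnitSphere k → ℝ}
    (hf : Continuous f) : Integrable f (uniformSphere k) :=
  hf.integrable_of_hasCompactSupport (HasCompactSupport.of_compactSpace f)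

lemma IsHarmonicBasis.continuous {d ℓ n : ℕ} {Y : Fin n → UnitSphere (d + 1) → ℝ}
    (hY : IsHarmonicBasis d ℓ Y) (m : Fin n) : Continuous (Y m) :=
  (hY.harmonic m).1.continuous

lemma IsHarmonicBasis.sum_sq_rotateSphere {d ℓ n : ℕ} {Y : Fin n → UnitSphere (d + 1) → ℝ}
    (hY : IsHarmonicBasis d ℓ Y)
    (R : EuclideanSpace ℝ (Fin (d + 1)) ≃ₗᵢ[ℝ] EuclideanSpace ℝ (Fin (d + 1)))
    (x : UnitSphere (d + 1)) :
    ∑ m, Y m (rotateSphere R x) ^ 2 = ∑ m, Y m x ^ 2 := by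
  choose U hU using fun m => hY.spanning _ ((hY.harmonic m).comp_rotateSphere R)
  have hYc := hY.continuous
  have hint : ∀ i j, Integrable (fun x => Y i x * Y j x) (uniformSphere (d + 1)) :=
    fun i j => integrable_of_continuous_sphere ((hYc i).mul (hYc j))
  have horth : Matrix.of U * (Matrix.of U).transpose = 1 := by
    ext m m'
    have hint' : ∀ i j, Integrable (fun x => U m i * Y i x * (U m' j * Y j x))
        (uniformSphere (d + 1)) := fun i j =>
      ((hint i j).const_mul (U m i * U m' j)).congr (Eventually.of_forall fun x => by ring)
    have h1 := integral_comp_rotateSphere R (fun x => Y m x * Y m' x)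
    rw [hY.orthonormal] at h1
    simp_rw [hU, Finset.sum_mul_sum] at h1
    rw [integral_finsetSum _ fun i _ => integrable_finsetSum _ fun j _ => hint' i j] at h1
    rw [Matrix.one_apply, ← h1, Matrix.mul_apply]
    refine Finset.sum_congr rfl fun i _ => ?_
    rw [integral_finsetSum _ fun j _ => hint' i j]
    have : ∀ j, ∫ x, U m i * Y i x * (U m' j * Y j x) ∂(uniformSphere (d + 1)) =
        U m i * U m' j * if i = j then 1 else 0 := by
      intro j
      rw [← hY.orthonormal, ← integral_const_mul]
      congr 1 with x
      ring
    simp [this]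
  have horth' := mul_eq_one_comm.1 horth
  have hij : ∀ i j, ∑ m, U m i * U m j = if i = j then 1 else 0 := by
    intro i j
    have := congrFun (congrFun horth' i) j
    rwa [Matrix.mul_apply, Matrix.one_apply] at this
  calc ∑ m, Y m (rotateSphere R x) ^ 2
      = ∑ m, ∑ i, ∑ j, U m i * U m j * (Y i x * Y j x) := by
        refine Finset.sum_congr rfl fun m _ => ?_
        rw [hU, sq, Finset.sum_mul_sum]
        refine Finset.sum_congr rfl fun i _ => Finset.sum_congr rfl fun j _ => ?_
        ring
    _ = ∑ i, ∑ j, (∑ m, U m i * U m j) * (Y i x * Y j x) := by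
        rw [Finset.sum_comm]
        refine Finset.sum_congr rfl fun i _ => ?_
        rw [Finset.sum_comm]
        simp_rw [Finset.sum_mul]
    _ = ∑ m, Y m x ^ 2 := by
        simp [hij, sq]

/-- The addition theorem on the diagonal: `∑ m, Y_m ^ 2` is rotation invariant, hence constant, and
its mean is the number of basis functions. -/
theorem IsHarmonicBasis.sum_sq_eq {d ℓ n : ℕ} {Y : Fin n → UnitSphere (d + 1) → ℝ}
    (hY : IsHarmonicBasis d ℓ Y) (x : UnitSphere (d + 1)) : ∑ m, Y m x ^ 2 = n := by
  have hconst : ∀ y, ∑ m, Y m y ^ 2 = ∑ m, Y m x ^ 2 := by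
    intro y
    have hn : ‖(x : EuclideanSpace ℝ (Fin (d + 1)))‖ =
        ‖(y : EuclideanSpace ℝ (Fin (d + 1)))‖ := by simp
    have h := hY.sum_sq_rotateSphere (Submodule.reflection
      (Submodule.span ℝ {(x : EuclideanSpace ℝ (Fin (d + 1))) - y})ᗮ) x
    have hy : rotateSphere (Submodule.reflection
      (Submodule.span ℝ {(x : EuclideanSpace ℝ (Fin (d + 1))) - y})ᗮ) x = y := by
      ext1
      exact Submodule.reflection_sub hn
    rwa [hy] at h
  have h1 : ∫ y, ∑ m, Y m y ^ 2 ∂(uniformSphere (d + 1)) = ∑ m, Y m x ^ 2 := by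
    simp [hconst]
  rw [← h1, integral_finsetSum _ fun m _ =>
    integrable_of_continuous_sphere (f := fun y => Y m y ^ 2) ((hY.continuous m).pow 2)]
  simp [sq, hY.orthonormal]

/-! ### Harmonic polynomials and the dimension of the eigenspace -/

/-- The Laplacian of a polynomial, as a linear map. -/
noncomputable def polyLaplacian (k : ℕ) :
    MvPolynomial (Fin k) ℝ →ₗ[ℝ] MvPolynomial (Fin k) ℝ :=
  ∑ i, (MvPolynomial.pderiv i).toLinearMap ∘ₗ (MvPolynomial.pderiv i).toLinearMap

lemma polyLaplacian_apply (k : ℕ) (p : MvPolynomial (Fin k) ℝ) :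
    polyLaplacian k p = ∑ i, MvPolynomial.pderiv i (MvPolynomial.pderiv i p) := by
  simp [polyLaplacian]

/-- Evaluation of a polynomial at a point of Euclidean space. -/
noncomputable def polyEval {k : ℕ} (p : MvPolynomial (Fin k) ℝ) (y : EuclideanSpace ℝ (Fin k)) :
    ℝ :=
  MvPolynomial.eval (fun i => y i) p

lemma hasFDerivAt_polyEval {k : ℕ} (p : MvPolynomial (Fin k) ℝ) (y : EuclideanSpace ℝ (Fin k)) :
    HasFDerivAt (polyEval p)
      (∑ i, polyEval (MvPolynomial.pderiv i p) y •
        (EuclideanSpace.proj i : EuclideanSpace ℝ (Fin k) →L[ℝ] ℝ)) y := by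
  induction p using MvPolynomial.induction_on with
  | C a =>
    have : polyEval (MvPolynomial.C a : MvPolynomial (Fin k) ℝ) = fun _ => a := by
      ext; simp [polyEval]
    rw [this]
    simpa [polyEval] using hasFDerivAt_const a y
  | add p q hp hq =>
    have : polyEval (p + q) = fun y => polyEval p y + polyEval q y := by
      ext; simp [polyEval]
    rw [this]
    refine (hp.fun_add hq).congr_fderiv ?_
    rw [← Finset.sum_add_distrib]
    simp [polyEval, add_smul]
  | mul_X p j hp =>
    have : polyEval (p * MvPolynomial.X j) = fun y => polyEval p y * y j := by
      ext; simp [polyEval]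
    rw [this]
    have hj : HasFDerivAt (fun y : EuclideanSpace ℝ (Fin k) => y j)
        (EuclideanSpace.proj j : EuclideanSpace ℝ (Fin k) →L[ℝ] ℝ) y :=
      (EuclideanSpace.proj j : EuclideanSpace ℝ (Fin k) →L[ℝ] ℝ).hasFDerivAt
    refine (hp.fun_mul hj).congr_fderiv ?_
    ext v
    simp only [MvPolynomial.pderiv_mul, MvPolynomial.pderiv_X, polyEval, map_add, map_mul,
      MvPolynomial.eval_X, add_smul, Finset.sum_add_distrib]
    simp [Finset.mul_sum, Pi.single_apply, apply_ite, Finset.sum_ite_eq]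
    rw [add_comm]
    congr 1
    refine Finset.sum_congr rfl fun i _ => ?_
    ring

lemma contDiff_polyEval {k : ℕ} (p : MvPolynomial (Fin k) ℝ) : ContDiff ℝ ∞ (polyEval p) := by
  induction p using MvPolynomial.induction_on with
  | C a =>
    have : polyEval (MvPolynomial.C a : MvPolynomial (Fin k) ℝ) = fun _ => a := by
      ext; simp [polyEval]
    rw [this]
    exact contDiff_const
  | add p q hp hq =>
    have : polyEval (p + q) = fun y => polyEval p y + polyEval q y := by
      ext; simp [polyEval]
    rw [this]
    exact hp.add hq
  | mul_X p j hp =>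
    have : polyEval (p * MvPolynomial.X j) = fun y => polyEval p y * y j := by
      ext; simp [polyEval]
    rw [this]
    exact hp.mul (EuclideanSpace.proj j : EuclideanSpace ℝ (Fin k) →L[ℝ] ℝ).contDiff

lemma polyEval_smul {k ℓ : ℕ} {p : MvPolynomial (Fin k) ℝ} (hp : p.IsHomogeneous ℓ) (r : ℝ)
    (y : EuclideanSpace ℝ (Fin k)) : polyEval p (r • y) = r ^ ℓ * polyEval p y := by
  rw [polyEval, polyEval, MvPolynomial.eval_eq', MvPolynomial.eval_eq', Finset.mul_sum]
  refine Finset.sum_congr rfl fun e he => ?_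
  have hdeg : ∑ i, e i = ℓ := by
    rw [← Finsupp.degree_eq_sum, Finsupp.degree_eq_weight_one]
    exact hp (MvPolynomial.mem_support_iff.1 he)
  simp only [PiLp.smul_apply, smul_eq_mul, mul_pow, Finset.prod_mul_distrib]
  rw [Finset.prod_pow_eq_pow_sum, hdeg]
  ring

/-- The radial extension of the restriction of a homogeneous polynomial to the sphere divides it by
the matching power of the norm. The squared norm is used because it is smooth. -/
lemma radialExtension_polyEval {k ℓ : ℕ} {p : MvPolynomial (Fin k) ℝ} (hp : p.IsHomogeneous ℓ)
    {y : EuclideanSpace ℝ (Fin k)} (hy : y ≠ 0) :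
    radialExtension (fun x : UnitSphere k => polyEval p x) y =
      (‖y‖ ^ 2) ^ (-(ℓ : ℝ) / 2) * polyEval p y := by
  simp only [radialExtension, dif_neg hy]
  rw [polyEval_smul hp, ← Real.rpow_natCast (‖y‖) 2, ← Real.rpow_mul (norm_nonneg _),
    inv_pow, ← Real.rpow_natCast, ← Real.rpow_neg (norm_nonneg _)]
  congr 2
  push_cast
  ring

lemma iteratedFDeriv_two_eq_of_eventually {k : ℕ} {F A : EuclideanSpace ℝ (Fin k) → ℝ}
    {x v : EuclideanSpace ℝ (Fin k)} {A' : EuclideanSpace ℝ (Fin k) →L[ℝ] ℝ}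
    (hF : ContDiffAt ℝ 2 F x) (hA : ∀ᶠ y in nhds x, fderiv ℝ F y v = A y)
    (hA' : HasFDerivAt A A' x) : iteratedFDeriv ℝ 2 F x ![v, v] = A' v := by
  rw [iteratedFDeriv_two_apply]
  simp only [Matrix.cons_val_zero, Matrix.cons_val_one]
  have hd : DifferentiableAt ℝ (fderiv ℝ F) x :=
    (hF.fderiv_right (m := 1) (by norm_num)).differentiableAt (by norm_num)
  have h1 : HasFDerivAt (fun y => fderiv ℝ F y v) ((fderiv ℝ (fderiv ℝ F) x).flip v) x := by
    have := hd.hasFDerivAt.clm_apply (hasFDerivAt_const v x)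
    simpa using this
  have h2 := (hA'.congr_of_eventuallyEq hA).unique h1
  rw [h2]
  rfl

/-- A homogeneous harmonic polynomial restricts to a spherical harmonic. -/
theorem isSphericalHarmonic_polyEval {d ℓ : ℕ} {p : MvPolynomial (Fin (d + 1)) ℝ}
    (hp : p.IsHomogeneous ℓ) (hΔ : polyLaplacian (d + 1) p = 0) :
    IsSphericalHarmonic d ℓ (fun x => polyEval p x) := by
  set F := radialExtension (fun x : UnitSphere (d + 1) => polyEval p x) with hF
  set s : ℝ := -(ℓ : ℝ) / 2 with hs
  have hFe : ∀ y : EuclideanSpace ℝ (Fin (d + 1)), y ≠ 0 →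
      F y = (‖y‖ ^ 2) ^ s * polyEval p y := fun y hy => radialExtension_polyEval hp hy
  have hsm : ContDiffOn ℝ ∞ F {0}ᶜ := by
    refine ContDiffOn.congr (f := fun y => (‖y‖ ^ 2) ^ s * polyEval p y) ?_ hFe
    refine ContDiffOn.mul ?_ (contDiff_polyEval p).contDiffOn
    intro y hy
    have hy' : ‖y‖ ^ 2 ≠ 0 := pow_ne_zero _ (norm_ne_zero_iff.2 hy)
    exact ((contDiff_norm_sq ℝ).contDiffAt.rpow_const_of_ne hy').contDiffWithinAt
  refine ⟨hsm, fun x => ?_⟩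
  have hx1 : ‖(x : EuclideanSpace ℝ (Fin (d + 1)))‖ = 1 := by simp
  set z : EuclideanSpace ℝ (Fin (d + 1)) := (x : EuclideanSpace ℝ (Fin (d + 1))) with hz
  have hz0 : z ≠ 0 := by rw [← norm_ne_zero_iff, hx1]; norm_num
  have hev : ∀ y : EuclideanSpace ℝ (Fin (d + 1)), y ≠ 0 → ∀ᶠ w in nhds y, w ≠ 0 := fun y hy =>
    isOpen_compl_singleton.mem_nhds hy
  -- derivatives of powers of `‖y‖ ^ 2`
  have hN : ∀ (r : ℝ) (y : EuclideanSpace ℝ (Fin (d + 1))), y ≠ 0 →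
      HasFDerivAt (fun y : EuclideanSpace ℝ (Fin (d + 1)) => (‖y‖ ^ 2) ^ r)
        ((r * (‖y‖ ^ 2) ^ (r - 1)) • (2 • innerSL ℝ y)) y := by
    intro r y hy
    exact (hasStrictFDerivAt_norm_sq y).hasFDerivAt.rpow_const
      (Or.inl (pow_ne_zero _ (norm_ne_zero_iff.2 hy)))
  set e := EuclideanSpace.basisFun (Fin (d + 1)) ℝ with he
  have hinner : ∀ (y : EuclideanSpace ℝ (Fin (d + 1))) i, inner ℝ y (e i) = y i := by
    intro y i
    simp [he, EuclideanSpace.inner_single_right]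
  have hei : ∀ i j, (e i) j = if j = i then 1 else 0 := by
    intro i j
    simp [he]
  have hP : ∀ (q : MvPolynomial (Fin (d + 1)) ℝ) (y : EuclideanSpace ℝ (Fin (d + 1))) i,
      (∑ j, polyEval (MvPolynomial.pderiv j q) y •
        (EuclideanSpace.proj j : EuclideanSpace ℝ (Fin (d + 1)) →L[ℝ] ℝ)) (e i) =
      polyEval (MvPolynomial.pderiv i q) y := by
    intro q y i
    simp [hei]
  have hgrad : ∀ i (y : EuclideanSpace ℝ (Fin (d + 1))), y ≠ 0 → fderiv ℝ F y (e i) =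
      (2 * s) * (y i * ((‖y‖ ^ 2) ^ (s - 1) * polyEval p y)) +
        (‖y‖ ^ 2) ^ s * polyEval (MvPolynomial.pderiv i p) y := by
    intro i y hy
    have h1 := (hN s y hy).fun_mul (hasFDerivAt_polyEval p y)
    have h2 := h1.congr_of_eventuallyEq ((hev y hy).mono hFe)
    rw [h2.fderiv]
    simp only [add_apply, smul_apply, hP, smul_eq_mul,
      innerSL_apply_apply, hinner, nsmul_eq_mul]
    push_cast
    ring
  have hsecond : ∀ i, iteratedFDeriv ℝ 2 F z ![e i, e i] =
      2 * s * polyEval p z + 4 * s * (s - 1) * z i ^ 2 * polyEval p z +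
        4 * s * (z i * polyEval (MvPolynomial.pderiv i p) z) +
        polyEval (MvPolynomial.pderiv i (MvPolynomial.pderiv i p)) z := by
    intro i
    have hj : HasFDerivAt (fun y : EuclideanSpace ℝ (Fin (d + 1)) => y i)
        (EuclideanSpace.proj i : EuclideanSpace ℝ (Fin (d + 1)) →L[ℝ] ℝ) z :=
      (EuclideanSpace.proj i : EuclideanSpace ℝ (Fin (d + 1)) →L[ℝ] ℝ).hasFDerivAt
    have h1 := ((hj.fun_mul ((hN (s - 1) z hz0).fun_mul (hasFDerivAt_polyEval p z))).const_mul
      (2 * s)).fun_add ((hN s z hz0).fun_mul (hasFDerivAt_polyEval (MvPolynomial.pderiv i p) z))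
    have hc : ContDiffAt ℝ 2 F z :=
      (hsm.contDiffAt (isOpen_compl_singleton.mem_nhds hz0)).of_le
        (WithTop.coe_le_coe.2 le_top)
    rw [iteratedFDeriv_two_eq_of_eventually hc ((hev z hz0).mono (hgrad i)) h1]
    simp only [add_apply, smul_apply, hP, smul_eq_mul,
      innerSL_apply_apply, hinner, nsmul_eq_mul, hx1, one_pow, Real.one_rpow,
      PiLp.proj_apply, hei]
    push_cast
    ring
  have heuler : ∑ i, z i * polyEval (MvPolynomial.pderiv i p) z = ℓ * polyEval p z := by
    have := congrArg (MvPolynomial.eval fun i => z i) hp.sum_X_mul_pderiv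
    simpa [polyEval] using this
  have hlap : ∑ i, polyEval (MvPolynomial.pderiv i (MvPolynomial.pderiv i p)) z = 0 := by
    have := congrArg (MvPolynomial.eval fun i => z i) hΔ
    simpa [polyEval, polyLaplacian_apply] using this
  have hsq : ∑ i, z i ^ 2 = 1 := by
    rw [← EuclideanSpace.real_norm_sq_eq, hx1, one_pow]
  rw [sphereLaplacian, ← hF, InnerProductSpace.laplacian_eq_iteratedFDeriv_orthonormalBasis _ e]
  simp only [← hz, hsecond, Finset.sum_add_distrib, hlap, ← Finset.mul_sum, ← Finset.sum_mul,
    heuler, hsq]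
  simp only [Finset.sum_const, Finset.card_univ, Fintype.card_fin, nsmul_eq_mul]
  push_cast
  rw [hs]
  ring

lemma finrank_homogeneousSubmodule (k ℓ : ℕ) :
    Module.finrank ℝ (MvPolynomial.homogeneousSubmodule (Fin k) ℝ ℓ) = (k + ℓ - 1).choose ℓ := by
  set S : Finset (Fin k →₀ ℕ) := Finset.univ.finsuppAntidiag ℓ with hS
  have hspan : MvPolynomial.homogeneousSubmodule (Fin k) ℝ ℓ =
      Submodule.span ℝ (Set.range fun e : S =>
        MvPolynomial.basisMonomials (Fin k) ℝ (e : Fin k →₀ ℕ)) := by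
    rw [MvPolynomial.homogeneousSubmodule_eq_finsupp_supported,
      AddMonoidAlgebra.supported_eq_span_single]
    congr 1
    ext p
    simp only [Set.mem_image, Set.mem_range, Subtype.exists, MvPolynomial.coe_basisMonomials, hS,
      Finset.mem_finsuppAntidiag, Set.mem_ofPred_eq, Finsupp.degree_eq_sum]
    simp [MvPolynomial.single_eq_monomial]
  have hli : LinearIndependent ℝ fun e : S =>
      MvPolynomial.basisMonomials (Fin k) ℝ (e : Fin k →₀ ℕ) :=
    (MvPolynomial.basisMonomials (Fin k) ℝ).linearIndependent.comp _ Subtype.val_injective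
  rw [hspan, finrank_span_eq_card hli, Fintype.card_coe, hS,
    Finset.card_finsuppAntidiag_nat_eq_choose]
  simp

instance finiteDimensional_homogeneousSubmodule (k ℓ : ℕ) :
    FiniteDimensional ℝ (MvPolynomial.homogeneousSubmodule (Fin k) ℝ ℓ) :=
  Module.Finite.iff_fg.2 (MvPolynomial.homogeneousSubmodule_fg _ _ _)

/-- The space of harmonic homogeneous polynomials of degree `ℓ`, as the kernel of the Laplacian on
the homogeneous polynomials. -/
noncomputable def harmonicKernel (k ℓ : ℕ) :
    Submodule ℝ (MvPolynomial.homogeneousSubmodule (Fin k) ℝ ℓ) :=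
  LinearMap.ker ((polyLaplacian k).domRestrict (MvPolynomial.homogeneousSubmodule (Fin k) ℝ ℓ))

lemma isHomogeneous_polyLaplacian {k ℓ : ℕ} {p : MvPolynomial (Fin k) ℝ}
    (hp : p.IsHomogeneous ℓ) : (polyLaplacian k p).IsHomogeneous (ℓ - 2) := by
  rw [polyLaplacian_apply]
  exact MvPolynomial.IsHomogeneous.sum _ _ _ fun i _ => hp.pderiv.pderiv

/-- The rank-nullity theorem bounds the dimension of the harmonic polynomials from below; the
surjectivity of the Laplacian is not needed for this. -/
lemma choose_le_finrank_harmonicKernel (d ℓ : ℕ) (hd : 1 ≤ d) :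
    (ℓ + d - 1).choose (d - 1) ≤ Module.finrank ℝ (harmonicKernel (d + 1) ℓ) := by
  have hrn := LinearMap.finrank_range_add_finrank_ker ((polyLaplacian (d + 1)).domRestrict
    (MvPolynomial.homogeneousSubmodule (Fin (d + 1)) ℝ ℓ))
  rw [finrank_homogeneousSubmodule] at hrn
  have hrange : LinearMap.range ((polyLaplacian (d + 1)).domRestrict
      (MvPolynomial.homogeneousSubmodule (Fin (d + 1)) ℝ ℓ)) ≤
      MvPolynomial.homogeneousSubmodule (Fin (d + 1)) ℝ (ℓ - 2) := by
    rintro _ ⟨p, rfl⟩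
    exact isHomogeneous_polyLaplacian p.2
  rw [harmonicKernel]
  obtain ⟨e, rfl⟩ := Nat.exists_eq_add_of_le' hd
  rcases ℓ with _ | l
  · -- in degree zero the Laplacian vanishes identically
    have h0 : LinearMap.range ((polyLaplacian (e + 1 + 1)).domRestrict
        (MvPolynomial.homogeneousSubmodule (Fin (e + 1 + 1)) ℝ 0)) = ⊥ := by
      rw [LinearMap.range_eq_bot]
      ext1 p
      have hc := MvPolynomial.totalDegree_eq_zero_iff_eq_C.1
        (Nat.le_zero.1 (MvPolynomial.IsHomogeneous.totalDegree_le p.2))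
      rw [LinearMap.domRestrict_apply, hc, polyLaplacian_apply]
      simp
    rw [h0, finrank_bot] at hrn
    simpa using hrn.ge
  · have h1 := Submodule.finrank_mono hrange
    rw [finrank_homogeneousSubmodule] at h1
    have h2 : (e + 1 + 1 + (l + 1 - 2) - 1).choose (l + 1 - 2) ≤ (e + 1 + l).choose l := by
      rcases l with _ | l
      · simp
      · rw [show e + 1 + 1 + (l + 1 + 1 - 2) - 1 = e + 1 + l by omega,
          show l + 1 + 1 - 2 = l by omega, ← add_assoc, Nat.choose_succ_succ]
        omega
    have h3 : (e + 1 + 1 + (l + 1) - 1).choose (l + 1) =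
        (e + 1 + l).choose l + (e + 1 + l).choose (l + 1) := by
      rw [show e + 1 + 1 + (l + 1) - 1 = e + 1 + l + 1 by omega, Nat.choose_succ_succ]
    have h4 : (l + 1 + (e + 1) - 1).choose (e + 1 - 1) = (e + 1 + l).choose (l + 1) := by
      rw [show l + 1 + (e + 1) - 1 = e + 1 + l by omega, Nat.add_sub_cancel]
      exact Nat.choose_symm_of_eq_add (by omega)
    omega

/-- The eigenspace contains the restrictions of the harmonic polynomials, which gives a lower bound
for its dimension. -/
theorem IsHarmonicBasis.choose_le {d ℓ n : ℕ} {Y : Fin n → UnitSphere (d + 1) → ℝ}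
    (hY : IsHarmonicBasis d ℓ Y) (hd : 1 ≤ d) : (ℓ + d - 1).choose (d - 1) ≤ n := by
  refine (choose_le_finrank_harmonicKernel d ℓ hd).trans ?_
  let res : harmonicKernel (d + 1) ℓ →ₗ[ℝ] (UnitSphere (d + 1) → ℝ) :=
    { toFun := fun p x => polyEval (p : MvPolynomial (Fin (d + 1)) ℝ) x
      map_add' := fun p q => by ext x; simp [polyEval]
      map_smul' := fun c p => by ext x; simp [polyEval, MvPolynomial.smul_eval] }
  have hmem : ∀ p, res p ∈ Submodule.span ℝ (Set.range Y) := by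
    intro p
    have hp : polyLaplacian (d + 1) p.1.1 = 0 := p.2
    obtain ⟨c, hc⟩ := hY.spanning _ (isSphericalHarmonic_polyEval p.1.2 hp)
    have : res p = ∑ m, c m • Y m := by
      ext x
      simpa [res] using hc x
    rw [this]
    exact Submodule.sum_mem _ fun m _ =>
      Submodule.smul_mem _ _ (Submodule.subset_span (Set.mem_range_self m))
  have hinj : Function.Injective res := by
    intro p q hpq
    ext1
    ext1
    refine MvPolynomial.funext fun y => ?_
    have h0 : ∀ z : EuclideanSpace ℝ (Fin (d + 1)), polyEval p.1.1 z = polyEval q.1.1 z := by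
      intro z
      obtain ⟨x, hx⟩ : ∃ x : UnitSphere (d + 1), z = ‖z‖ • (x : EuclideanSpace ℝ _) := by
        by_cases hz : z = 0
        · exact ⟨⟨EuclideanSpace.single 0 1, by simp⟩, by simp [hz]⟩
        · have hz' : ‖z‖ ≠ 0 := norm_ne_zero_iff.2 hz
          exact ⟨⟨‖z‖⁻¹ • z, by simp [norm_smul, hz']⟩, by simp [smul_smul, hz']⟩
      have hx0 : polyEval p.1.1 x = polyEval q.1.1 x := congrFun hpq x
      rw [hx, polyEval_smul p.1.2, polyEval_smul q.1.2, hx0]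
    simpa [polyEval] using h0 (WithLp.toLp 2 y)
  have := FiniteDimensional.span_of_finite ℝ (Set.finite_range Y)
  calc Module.finrank ℝ (harmonicKernel (d + 1) ℓ)
      ≤ Module.finrank ℝ (Submodule.span ℝ (Set.range Y)) :=
        LinearMap.finrank_le_finrank_of_injective (f := res.codRestrict _ hmem)
          (fun p q h => hinj (congrArg Subtype.val h))
    _ ≤ Fintype.card (Fin n) := finrank_range_le_card Y
    _ = n := Fintype.card_fin n

/-! ### Variance of the empirical distribution function of a Gaussian field -/

lemma integral_measureReal_prodMk_comm {α β : Type*} [MeasurableSpace α] [MeasurableSpace β]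
    (P : Measure α) (Q : Measure β) [IsFiniteMeasure P] [IsFiniteMeasure Q] {A : Set (α × β)}
    (hA : MeasurableSet A) :
    ∫ a, Q.real {b | (a, b) ∈ A} ∂P = ∫ b, P.real {a | (a, b) ∈ A} ∂Q := by
  have h1 : ∫ a, Q.real {b | (a, b) ∈ A} ∂P = (P.prod Q A).toReal := by
    rw [Measure.prod_apply hA]
    exact integral_toReal (measurable_measure_prodMk_left hA).aemeasurable
      (Eventually.of_forall fun _ => measure_lt_top _ _)
  have h2 : ∫ b, P.real {a | (a, b) ∈ A} ∂Q = (P.prod Q A).toReal := by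
    rw [Measure.prod_apply_symm hA]
    exact integral_toReal (measurable_measure_prodMk_right hA).aemeasurable
      (Eventually.of_forall fun _ => measure_lt_top _ _)
  rw [h1, h2]

lemma integrable_of_measurable_of_abs_le {α : Type*} [MeasurableSpace α] {P : Measure α}
    [IsFiniteMeasure P] {f : α → ℝ} (hf : Measurable f) (C : ℝ) (h : ∀ a, |f a| ≤ C) :
    Integrable f P :=
  Integrable.of_bound hf.aestronglyMeasurable C (Eventually.of_forall h)

/-- For a family `e` of vectors indexed by a probability space and a vector `g`, the distribution
function of `x ↦ ⟪e x, g⟫`. -/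
noncomputable def fieldCDF {S : Type*} [MeasurableSpace S] (μ : Measure S) {n : ℕ}
    (e : S → EuclideanSpace ℝ (Fin n)) (g : EuclideanSpace ℝ (Fin n)) (u : ℝ) : ℝ :=
  μ.real {x | inner ℝ (e x) g ≤ u}

section Field

variable {S : Type*} [MeasurableSpace S] (μ : Measure S) {n : ℕ}
  {e : S → EuclideanSpace ℝ (Fin n)}

lemma fieldCDF_nonneg (g : EuclideanSpace ℝ (Fin n)) (u : ℝ) : 0 ≤ fieldCDF μ e g u :=
  measureReal_nonneg

variable [IsProbabilityMeasure μ]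

lemma fieldCDF_le_one (g : EuclideanSpace ℝ (Fin n)) (u : ℝ) : fieldCDF μ e g u ≤ 1 :=
  measureReal_le_one

lemma monotone_fieldCDF (g : EuclideanSpace ℝ (Fin n)) : Monotone (fieldCDF μ e g) :=
  fun _ _ h => measureReal_mono fun _ hx => le_trans hx h

lemma measurable_fieldCDF (he : Measurable e) (u : ℝ) :
    Measurable fun g => fieldCDF μ e g u := by
  have hA : MeasurableSet {p : EuclideanSpace ℝ (Fin n) × S | inner ℝ (e p.2) p.1 ≤ u} :=
    measurableSet_le (by fun_prop) (by fun_prop)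
  exact (measurable_measure_prodMk_left hA).ennreal_toReal

lemma integral_fieldCDF (he : Measurable e) (he1 : ∀ x, ‖e x‖ = 1) (u : ℝ) :
    ∫ g, fieldCDF μ e g u ∂(stdGaussian (EuclideanSpace ℝ (Fin n))) = normalCDF u := by
  have hA : MeasurableSet {p : EuclideanSpace ℝ (Fin n) × S | inner ℝ (e p.2) p.1 ≤ u} :=
    measurableSet_le (by fun_prop) (by fun_prop)
  have h := integral_measureReal_prodMk_comm (stdGaussian (EuclideanSpace ℝ (Fin n))) μ hA
  have h2 : ∀ x, (stdGaussian (EuclideanSpace ℝ (Fin n))).real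
      {g | (g, x) ∈ {p : EuclideanSpace ℝ (Fin n) × S | inner ℝ (e p.2) p.1 ≤ u}} =
      normalCDF u := by
    intro x
    rw [normalCDF, ← map_inner_stdGaussian (he1 x),
      map_measureReal_apply (by fun_prop) measurableSet_Iic]
    rfl
  simp only [h2] at h
  simpa [fieldCDF] using h

lemma integral_fieldCDF_sq_le (he : Measurable e) (he1 : ∀ x, ‖e x‖ = 1) (u : ℝ) :
    ∫ g, fieldCDF μ e g u ^ 2 ∂(stdGaussian (EuclideanSpace ℝ (Fin n))) ≤
      normalCDF u ^ 2 + (∫ p, inner ℝ (e p.1) (e p.2) ∂(μ.prod μ)) * normalPDF u ^ 2 +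
        8 * ∫ p, inner ℝ (e p.1) (e p.2) ^ 2 ∂(μ.prod μ) := by
  have hA : MeasurableSet {p : EuclideanSpace ℝ (Fin n) × (S × S) |
      inner ℝ (e p.2.1) p.1 ≤ u ∧ inner ℝ (e p.2.2) p.1 ≤ u} :=
    MeasurableSet.inter
      (s₁ := {p : EuclideanSpace ℝ (Fin n) × (S × S) | inner ℝ (e p.2.1) p.1 ≤ u})
      (s₂ := {p : EuclideanSpace ℝ (Fin n) × (S × S) | inner ℝ (e p.2.2) p.1 ≤ u})
      (measurableSet_le (by fun_prop) (by fun_prop)) (measurableSet_le (by fun_prop) (by fun_prop))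
  have h := integral_measureReal_prodMk_comm (stdGaussian (EuclideanSpace ℝ (Fin n)))
    (μ.prod μ) hA
  have hsq : ∀ g, fieldCDF μ e g u ^ 2 = (μ.prod μ).real {p | (g, p) ∈
      {p : EuclideanSpace ℝ (Fin n) × (S × S) |
        inner ℝ (e p.2.1) p.1 ≤ u ∧ inner ℝ (e p.2.2) p.1 ≤ u}} := by
    intro g
    rw [sq, fieldCDF, ← measureReal_prod_prod]
    rfl
  have hρ : ∀ p : S × S, |inner ℝ (e p.1) (e p.2)| ≤ 1 := fun p => by
    simpa [he1] using abs_real_inner_le_norm (e p.1) (e p.2)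
  have hi1 : Integrable (fun p : S × S => inner ℝ (e p.1) (e p.2)) (μ.prod μ) :=
    integrable_of_measurable_of_abs_le (by fun_prop) 1 hρ
  have hi2 : Integrable (fun p : S × S => inner ℝ (e p.1) (e p.2) ^ 2) (μ.prod μ) :=
    integrable_of_measurable_of_abs_le (by fun_prop) 1 fun p => by
      rw [abs_pow]; exact pow_le_one₀ (abs_nonneg _) (hρ p)
  have hi3 : Integrable (fun p : S × S => normalCDF u ^ 2 +
      inner ℝ (e p.1) (e p.2) * normalPDF u ^ 2) (μ.prod μ) :=
    (integrable_const _).add (hi1.mul_const _)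
  have hi4 : Integrable (fun p : S × S => normalCDF u ^ 2 +
      inner ℝ (e p.1) (e p.2) * normalPDF u ^ 2 + 8 * inner ℝ (e p.1) (e p.2) ^ 2)
      (μ.prod μ) := hi3.add (hi2.const_mul _)
  simp only [hsq]
  rw [h]
  calc _ ≤ ∫ p, (normalCDF u ^ 2 + inner ℝ (e p.1) (e p.2) * normalPDF u ^ 2 +
        8 * inner ℝ (e p.1) (e p.2) ^ 2) ∂(μ.prod μ) :=
        integral_mono_of_nonneg (Eventually.of_forall fun _ => measureReal_nonneg) hi4
          (Eventually.of_forall fun p => stdGaussian_quadrant_le (he1 p.1) (he1 p.2) u)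
    _ = _ := by
        rw [integral_add hi3 (hi2.const_mul _), integral_add (integrable_const _)
          (hi1.mul_const _), integral_mul_const, integral_const_mul]
        simp

/-- The distribution function of a Gaussian field with unit variances has mean `Φ u`, and its
variance is controlled by the first two moments of the correlation kernel. -/
theorem integral_fieldCDF_sub_sq_le (he : Measurable e) (he1 : ∀ x, ‖e x‖ = 1) (u : ℝ) :
    Integrable (fun g => (fieldCDF μ e g u - normalCDF u) ^ 2)
      (stdGaussian (EuclideanSpace ℝ (Fin n))) ∧
    ∫ g, (fieldCDF μ e g u - normalCDF u) ^ 2 ∂(stdGaussian (EuclideanSpace ℝ (Fin n))) ≤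
      (∫ p, inner ℝ (e p.1) (e p.2) ∂(μ.prod μ)) * normalPDF u ^ 2 +
        8 * ∫ p, inner ℝ (e p.1) (e p.2) ^ 2 ∂(μ.prod μ) := by
  have hm := measurable_fieldCDF μ he u
  have hb : ∀ g, |fieldCDF μ e g u| ≤ 1 := fun g => by
    rw [abs_of_nonneg (fieldCDF_nonneg μ g u)]; exact fieldCDF_le_one μ g u
  have hi1 : Integrable (fun g => fieldCDF μ e g u) (stdGaussian (EuclideanSpace ℝ (Fin n))) :=
    integrable_of_measurable_of_abs_le hm 1 hb
  have hi2 : Integrable (fun g => fieldCDF μ e g u ^ 2)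
      (stdGaussian (EuclideanSpace ℝ (Fin n))) :=
    integrable_of_measurable_of_abs_le (hm.pow_const 2) 1 fun g => by
      rw [abs_pow]; exact pow_le_one₀ (abs_nonneg _) (hb g)
  have hi3 : Integrable (fun g => fieldCDF μ e g u ^ 2 - 2 * normalCDF u * fieldCDF μ e g u)
      (stdGaussian (EuclideanSpace ℝ (Fin n))) := hi2.sub (hi1.const_mul _)
  have heq : ∀ g, (fieldCDF μ e g u - normalCDF u) ^ 2 =
      fieldCDF μ e g u ^ 2 - 2 * normalCDF u * fieldCDF μ e g u + normalCDF u ^ 2 :=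
    fun g => by ring
  simp only [heq]
  refine ⟨hi3.add (integrable_const _), ?_⟩
  rw [integral_add hi3 (integrable_const _), integral_sub hi2 (hi1.const_mul _),
    integral_const_mul, integral_fieldCDF μ he he1]
  have := integral_fieldCDF_sq_le μ he he1 u
  simp only [integral_const, probReal_univ, smul_eq_mul, one_mul]
  nlinarith

end Field

/-! ### Discretization of the Kolmogorov distance -/

lemma exists_normalCDF_eq {p : ℝ} (h0 : 0 < p) (h1 : p < 1) : ∃ u, normalCDF u = p := by
  have hcdf : ∀ u, cdf (gaussianReal 0 1) u = normalCDF u := fun u => cdf_eq_real _ u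
  have hb := (tendsto_cdf_atBot (gaussianReal 0 1)).eventually (gt_mem_nhds h0)
  have ht := (tendsto_cdf_atTop (gaussianReal 0 1)).eventually (lt_mem_nhds h1)
  obtain ⟨a, ha⟩ := hb.exists
  obtain ⟨b, hb⟩ := ht.exists
  rw [hcdf] at ha hb
  exact mem_range_of_exists_le_of_exists_ge continuous_normalCDF ⟨a, ha.le⟩ ⟨b, hb.le⟩

/-- Comparison of a distribution function with `Φ` at the `N`-quantiles of `Φ` controls the uniform
distance up to `1 / N`, by monotonicity. -/
lemma abs_sub_normalCDF_le_of_quantiles {F : ℝ → ℝ} (hF : Monotone F) (h0 : ∀ u, 0 ≤ F u)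
    (h1 : ∀ u, F u ≤ 1) {N : ℕ} (hN : 0 < N) {t : ℕ → ℝ}
    (ht : ∀ i ∈ Finset.Ico 1 N, normalCDF (t i) = i / N) {B : ℝ} (hB0 : 0 ≤ B)
    (hB : ∀ i ∈ Finset.Ico 1 N, |F (t i) - normalCDF (t i)| ≤ B) (u : ℝ) :
    |F u - normalCDF u| ≤ B + 1 / N := by
  have hN' : (0 : ℝ) < N := by exact_mod_cast hN
  have hΦ0 := normalCDF_nonneg u
  have hΦ1 := normalCDF_le_one u
  rw [abs_le]
  constructor
  · set j := ⌈N * normalCDF u⌉₊ with hj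
    have hj1 : N * normalCDF u ≤ j := Nat.le_ceil _
    have hj2 : (j : ℝ) < N * normalCDF u + 1 := Nat.ceil_lt_add_one (by positivity)
    rcases le_or_gt j 1 with h | h
    · have : (j : ℝ) ≤ 1 := by exact_mod_cast h
      have : normalCDF u ≤ 1 / N := by rw [le_div_iff₀ hN']; linarith
      linarith [h0 u]
    · obtain ⟨i, hi⟩ : ∃ i, j = i + 1 := ⟨j - 1, by omega⟩
      have hij : (j : ℝ) = i + 1 := by rw [hi]; push_cast; ring
      have hiN : i < N := by
        have : (i : ℝ) < N := by nlinarith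
        exact_mod_cast this
      have hmem : i ∈ Finset.Ico 1 N := Finset.mem_Ico.2 ⟨by omega, hiN⟩
      have hlt : normalCDF (t i) < normalCDF u := by
        rw [ht i hmem, div_lt_iff₀ hN']; linarith
      have htu : t i ≤ u := le_of_lt (monotone_normalCDF.reflect_lt hlt)
      have h2 := hF htu
      have h3 := (abs_le.1 (hB i hmem)).1
      rw [ht i hmem] at h3
      have h4 : normalCDF u ≤ i / N + 1 / N := by
        rw [← add_div, le_div_iff₀ hN']; linarith
      linarith
  · set j := ⌊N * normalCDF u⌋₊ with hj
    have hj1 : (j : ℝ) ≤ N * normalCDF u := Nat.floor_le (by positivity)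
    have hj2 : N * normalCDF u < j + 1 := Nat.lt_floor_add_one _
    rcases lt_or_ge (j + 1) N with h | h
    · have hmem : j + 1 ∈ Finset.Ico 1 N := Finset.mem_Ico.2 ⟨by omega, h⟩
      have hlt : normalCDF u < normalCDF (t (j + 1)) := by
        rw [ht _ hmem, lt_div_iff₀ hN']; push_cast; linarith
      have htu : u ≤ t (j + 1) := le_of_lt (monotone_normalCDF.reflect_lt hlt)
      have h2 := hF htu
      have h3 := (abs_le.1 (hB _ hmem)).2
      rw [ht _ hmem] at h3
      have h4 : ((j + 1 : ℕ) : ℝ) / N ≤ normalCDF u + 1 / N := by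
        rw [div_le_iff₀ hN', add_mul, one_div, inv_mul_cancel₀ hN'.ne']; push_cast; linarith
      linarith
    · have : (N : ℝ) ≤ j + 1 := by exact_mod_cast h
      have : 1 ≤ normalCDF u + 1 / N := by
        rw [← sub_le_iff_le_add, ← sub_nonneg]
        have h5 : normalCDF u - (1 - 1 / N) = (N * normalCDF u + 1 - N) / N := by
          field_simp
          ring
        rw [h5]
        apply div_nonneg _ hN'.le
        linarith
      linarith [h1 u]

lemma abs_le_inv_add_mul_sq (a : ℝ) {N : ℝ} (hN : 0 < N) :
    |a| ≤ 1 / (2 * N) + N / 2 * a ^ 2 := by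
  have h : 1 / (2 * N) + N / 2 * a ^ 2 - |a| = (N * |a| - 1) ^ 2 / (2 * N) := by
    rw [← sq_abs a]
    field_simp
    ring
  have : 0 ≤ (N * |a| - 1) ^ 2 / (2 * N) := by positivity
  linarith

lemma abs_sub_normalCDF_le_sum_sq {F : ℝ → ℝ} (hF : Monotone F) (h0 : ∀ u, 0 ≤ F u)
    (h1 : ∀ u, F u ≤ 1) {N : ℕ} (hN : 0 < N) {t : ℕ → ℝ}
    (ht : ∀ i ∈ Finset.Ico 1 N, normalCDF (t i) = i / N) (u : ℝ) :
    |F u - normalCDF u| ≤ 3 / (2 * N) +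
      N / 2 * ∑ i ∈ Finset.Ico 1 N, (F (t i) - normalCDF (t i)) ^ 2 := by
  have hN' : (0 : ℝ) < N := by exact_mod_cast hN
  have hs : 0 ≤ ∑ i ∈ Finset.Ico 1 N, (F (t i) - normalCDF (t i)) ^ 2 :=
    Finset.sum_nonneg fun i _ => sq_nonneg _
  have := abs_sub_normalCDF_le_of_quantiles hF h0 h1 hN ht
    (B := 1 / (2 * N) + N / 2 * ∑ i ∈ Finset.Ico 1 N, (F (t i) - normalCDF (t i)) ^ 2)
    (by positivity) (fun i hi => (abs_le_inv_add_mul_sq _ hN').trans ?_) u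
  · refine this.trans (le_of_eq ?_)
    field_simp
    ring
  · gcongr
    exact Finset.single_le_sum (f := fun i => (F (t i) - normalCDF (t i)) ^ 2)
      (fun i _ => sq_nonneg _) hi

/-! ### The Gaussian defect of a random eigenfunction -/

/-- The vector `(Y_m(x) / √n)_m`, of length one by the addition theorem. -/
noncomputable def featureVector {d n : ℕ} (Y : Fin n → UnitSphere (d + 1) → ℝ)
    (x : UnitSphere (d + 1)) : EuclideanSpace ℝ (Fin n) :=
  WithLp.toLp 2 fun m => Y m x / √n

section

variable {d ℓ n : ℕ} {Y : Fin n → UnitSphere (d + 1) → ℝ}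

lemma inner_featureVector (x y : UnitSphere (d + 1)) :
    inner ℝ (featureVector Y x) (featureVector Y y) = (∑ m, Y m x * Y m y) / n := by
  simp only [featureVector, PiLp.inner_apply, RCLike.inner_apply, conj_trivial, Finset.sum_div]
  refine Finset.sum_congr rfl fun m _ => ?_
  rw [div_mul_div_comm, Real.mul_self_sqrt (Nat.cast_nonneg n), mul_comm]

lemma inner_featureVector_left (x : UnitSphere (d + 1))
    (g : EuclideanSpace ℝ (Fin n)) :
    inner ℝ (featureVector Y x) g = (∑ m, g m * Y m x) / √n := by
  simp only [featureVector, PiLp.inner_apply, RCLike.inner_apply, conj_trivial, Finset.sum_div]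
  refine Finset.sum_congr rfl fun m _ => ?_
  rw [mul_div_assoc]

lemma IsHarmonicBasis.continuous_featureVector (hY : IsHarmonicBasis d ℓ Y) :
    Continuous (featureVector Y) :=
  (PiLp.continuous_toLp 2 _).comp (continuous_pi fun m => (hY.continuous m).div_const _)

lemma IsHarmonicBasis.norm_featureVector [NeZero n] (hY : IsHarmonicBasis d ℓ Y)
    (x : UnitSphere (d + 1)) : ‖featureVector Y x‖ = 1 := by
  have h : ‖featureVector Y x‖ ^ 2 = 1 := by
    rw [← real_inner_self_eq_norm_sq, inner_featureVector]
    simp only [← sq, hY.sum_sq_eq]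
    exact div_self (NeZero.ne _)
  exact (pow_eq_one_iff_of_nonneg (norm_nonneg _) two_ne_zero).1 h

/-- Bessel's inequality for the constant function `1`. -/
lemma IsHarmonicBasis.sum_sq_integral_le (hY : IsHarmonicBasis d ℓ Y) :
    ∑ m, (∫ x, Y m x ∂(uniformSphere (d + 1))) ^ 2 ≤ 1 := by
  set c := fun m => ∫ x, Y m x ∂(uniformSphere (d + 1))
  have hi : ∀ m, Integrable (Y m) (uniformSphere (d + 1)) := fun m =>
    integrable_of_continuous_sphere (hY.continuous m)
  have hij : ∀ m m', Integrable (fun x => Y m x * Y m' x) (uniformSphere (d + 1)) := fun m m' =>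
    integrable_of_continuous_sphere ((hY.continuous m).mul (hY.continuous m'))
  have h1 : ∫ x, ∑ m, c m * Y m x ∂(uniformSphere (d + 1)) = ∑ m, c m ^ 2 := by
    rw [integral_finsetSum _ fun m _ => (hi m).const_mul _]
    refine Finset.sum_congr rfl fun m _ => ?_
    rw [integral_const_mul, sq]
  have h2 : ∫ x, ∑ m, ∑ m', c m * c m' * (Y m x * Y m' x) ∂(uniformSphere (d + 1)) =
      ∑ m, c m ^ 2 := by
    rw [integral_finsetSum _ fun m _ => integrable_finsetSum _ fun m' _ => (hij m m').const_mul _]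
    refine Finset.sum_congr rfl fun m _ => ?_
    rw [integral_finsetSum _ fun m' _ => (hij m m').const_mul _]
    simp [integral_const_mul, hY.orthonormal, sq]
  have hi1 : Integrable (fun x => ∑ m, c m * Y m x) (uniformSphere (d + 1)) :=
    integrable_finsetSum _ fun m _ => (hi m).const_mul _
  have hi2 : Integrable (fun x => ∑ m, ∑ m', c m * c m' * (Y m x * Y m' x))
      (uniformSphere (d + 1)) :=
    integrable_finsetSum _ fun m _ => integrable_finsetSum _ fun m' _ => (hij m m').const_mul _
  have hi3 : Integrable (fun x => (1 : ℝ) - 2 * ∑ m, c m * Y m x) (uniformSphere (d + 1)) :=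
    (integrable_const _).sub (hi1.const_mul _)
  have h3 : 0 ≤ ∫ x, (1 - 2 * (∑ m, c m * Y m x) +
      ∑ m, ∑ m', c m * c m' * (Y m x * Y m' x)) ∂(uniformSphere (d + 1)) := by
    refine integral_nonneg fun x => ?_
    have : ∑ m, ∑ m', c m * c m' * (Y m x * Y m' x) = (∑ m, c m * Y m x) ^ 2 := by
      rw [sq, Finset.sum_mul_sum]
      refine Finset.sum_congr rfl fun m _ => Finset.sum_congr rfl fun m' _ => ?_
      ring
    simp only [this, Pi.zero_apply]
    nlinarith [sq_nonneg (1 - ∑ m, c m * Y m x)]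
  rw [integral_add hi3 hi2, integral_sub (integrable_const _) (hi1.const_mul _),
    integral_const_mul, h1, h2] at h3
  simp only [integral_const, probReal_univ, smul_eq_mul, one_mul] at h3
  linarith

lemma IsHarmonicBasis.integral_kernel_le (hY : IsHarmonicBasis d ℓ Y) :
    ∫ p, inner ℝ (featureVector Y p.1) (featureVector Y p.2)
      ∂((uniformSphere (d + 1)).prod (uniformSphere (d + 1))) ≤ 1 / n := by
  have hi : ∀ m, Integrable (Y m) (uniformSphere (d + 1)) := fun m =>
    integrable_of_continuous_sphere (hY.continuous m)
  simp only [inner_featureVector]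
  rw [integral_div, integral_finsetSum _ fun m _ => (hi m).mul_prod (hi m)]
  simp only [integral_prod_mul]
  gcongr
  simpa [sq] using hY.sum_sq_integral_le

lemma IsHarmonicBasis.integral_kernel_sq [NeZero n] (hY : IsHarmonicBasis d ℓ Y) :
    ∫ p, inner ℝ (featureVector Y p.1) (featureVector Y p.2) ^ 2
      ∂((uniformSphere (d + 1)).prod (uniformSphere (d + 1))) = 1 / n := by
  have hij : ∀ m m', Integrable (fun x => Y m x * Y m' x) (uniformSphere (d + 1)) := fun m m' =>
    integrable_of_continuous_sphere ((hY.continuous m).mul (hY.continuous m'))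
  have hsq : ∀ p : UnitSphere (d + 1) × UnitSphere (d + 1),
      inner ℝ (featureVector Y p.1) (featureVector Y p.2) ^ 2 =
      (∑ m, ∑ m', (Y m p.1 * Y m' p.1) * (Y m p.2 * Y m' p.2)) / n ^ 2 := by
    intro p
    rw [inner_featureVector, div_pow, sq (∑ m, _), Finset.sum_mul_sum]
    congr 1
    refine Finset.sum_congr rfl fun m _ => Finset.sum_congr rfl fun m' _ => ?_
    ring
  have hn : (n : ℝ) ≠ 0 := NeZero.ne _
  simp only [hsq]
  rw [integral_div, integral_finsetSum _ fun m _ => integrable_finsetSum _ fun m' _ =>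
    (hij m m').mul_prod (hij m m')]
  have : ∀ m, ∫ p, ∑ m', (Y m p.1 * Y m' p.1) * (Y m p.2 * Y m' p.2)
      ∂((uniformSphere (d + 1)).prod (uniformSphere (d + 1))) = 1 := by
    intro m
    rw [integral_finsetSum _ fun m' _ => (hij m m').mul_prod (hij m m')]
    have h : ∀ m', ∫ p : UnitSphere (d + 1) × UnitSphere (d + 1),
        (Y m p.1 * Y m' p.1) * (Y m p.2 * Y m' p.2)
        ∂((uniformSphere (d + 1)).prod (uniformSphere (d + 1))) = if m = m' then 1 else 0 := by
      intro m'
      rw [integral_prod_mul (fun x => Y m x * Y m' x) (fun x => Y m x * Y m' x), hY.orthonormal]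
      simp
    simp [h]
  simp only [this, Finset.sum_const, Finset.card_univ, Fintype.card_fin, nsmul_eq_mul]
  field_simp

lemma IsHarmonicBasis.measurable_eigenfunction (hY : IsHarmonicBasis d ℓ Y) (α : UnitSphere n) :
    Measurable (eigenfunction Y α) := by
  have : Continuous (eigenfunction Y α) :=
    continuous_finsetSum _ fun m _ => continuous_const.mul (hY.continuous m)
  exact this.measurable

lemma IsHarmonicBasis.map_real_Iic (hY : IsHarmonicBasis d ℓ Y) (α : UnitSphere n) (u : ℝ) :
    ((uniformSphere (d + 1)).map (eigenfunction Y α)).real (Set.Iic u) =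
      (uniformSphere (d + 1)).real {x | eigenfunction Y α x ≤ u} := by
  rw [map_measureReal_apply (hY.measurable_eigenfunction α) measurableSet_Iic]
  rfl

lemma IsHarmonicBasis.gaussianDefect_eq (hY : IsHarmonicBasis d ℓ Y) (α : UnitSphere n) :
    gaussianDefect Y α = ⨆ u : ℝ,
      |(uniformSphere (d + 1)).real {x | eigenfunction Y α x ≤ u} - normalCDF u| := by
  simp only [gaussianDefect, kolmogorovDist, hY.map_real_Iic, normalCDF]

lemma gaussianDefect_nonneg (α : UnitSphere n) : 0 ≤ gaussianDefect Y α :=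
  Real.iSup_nonneg fun _ => abs_nonneg _

/-- The distribution function of the eigenfunction with coefficient vector `g / ‖g‖` is a rescaling
of that of the field `x ↦ ⟪featureVector Y x, g⟫`. -/
lemma measureReal_eigenfunction_le [NeZero n] {g : EuclideanSpace ℝ (Fin n)} (hg : g ≠ 0)
    (hg' : ‖g‖⁻¹ • g ∈ Metric.sphere (0 : EuclideanSpace ℝ (Fin n)) 1) (u : ℝ) :
    (uniformSphere (d + 1)).real {x | eigenfunction Y ⟨‖g‖⁻¹ • g, hg'⟩ x ≤ u} =
      fieldCDF (uniformSphere (d + 1)) (featureVector Y) g (u * (‖g‖ / √n)) := by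
  rw [fieldCDF]
  congr 1
  ext x
  have hn : (0 : ℝ) < √n := Real.sqrt_pos.2 (Nat.cast_pos.2 (NeZero.pos n))
  have hg0 : 0 < ‖g‖ := norm_pos_iff.2 hg
  have h : eigenfunction Y ⟨‖g‖⁻¹ • g, hg'⟩ x = (∑ m, g m * Y m x) / ‖g‖ := by
    rw [eigenfunction, Finset.sum_div]
    refine Finset.sum_congr rfl fun m _ => ?_
    simp only [PiLp.smul_apply, smul_eq_mul]
    ring
  simp only [Set.mem_ofPred_eq, h, inner_featureVector_left]
  rw [div_le_iff₀ hg0, ← mul_div_assoc, div_le_div_iff_of_pos_right hn]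

/-- Passing from the Gaussian vector `g` to the uniform vector `g / ‖g‖` costs only the fluctuation
of the norm, because the Kolmogorov distance is uniform in the level. -/
lemma IsHarmonicBasis.radialExtension_gaussianDefect_le [NeZero n] (hY : IsHarmonicBasis d ℓ Y)
    {N : ℕ} (hN : 0 < N) {t : ℕ → ℝ} (ht : ∀ i ∈ Finset.Ico 1 N, normalCDF (t i) = i / N)
    (g : EuclideanSpace ℝ (Fin n)) :
    radialExtension (gaussianDefect Y) g ≤ 5 / (2 * N) + N / 2 * (∑ i ∈ Finset.Ico 1 N,
        (fieldCDF (uniformSphere (d + 1)) (featureVector Y) g (t i) - normalCDF (t i)) ^ 2) +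
      N * (‖g‖ ^ 2 / n - 1) ^ 2 := by
  have hN' : (0 : ℝ) < N := by exact_mod_cast hN
  have hs : 0 ≤ ∑ i ∈ Finset.Ico 1 N,
      (fieldCDF (uniformSphere (d + 1)) (featureVector Y) g (t i) - normalCDF (t i)) ^ 2 :=
    Finset.sum_nonneg fun i _ => sq_nonneg _
  by_cases hg : g = 0
  · rw [radialExtension, dif_pos hg]
    positivity
  · have hg' : ‖g‖⁻¹ • g ∈ Metric.sphere (0 : EuclideanSpace ℝ (Fin n)) 1 := by
      simp [norm_smul, hg]
    rw [radialExtension_apply _ hg hg', hY.gaussianDefect_eq]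
    refine ciSup_le fun u => ?_
    rw [measureReal_eigenfunction_le hg hg']
    set r := ‖g‖ / √n with hr
    have hr0 : 0 ≤ r := by positivity
    have hr2 : r ^ 2 = ‖g‖ ^ 2 / n := by
      rw [hr, div_pow, Real.sq_sqrt (Nat.cast_nonneg n)]
    have h1 := abs_sub_normalCDF_le_sum_sq
      (monotone_fieldCDF (uniformSphere (d + 1)) (e := featureVector Y) g)
      (fieldCDF_nonneg _ g) (fieldCDF_le_one _ g) hN ht (u * r)
    have h2 := abs_normalCDF_mul_sub_le u r
    have h3 : |r - 1| ≤ |‖g‖ ^ 2 / n - 1| := by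
      rw [← hr2, show r ^ 2 - 1 = (r - 1) * (r + 1) by ring, abs_mul,
        abs_of_nonneg (by linarith : 0 ≤ r + 1)]
      nlinarith [abs_nonneg (r - 1)]
    have h4 := abs_le_inv_add_mul_sq (‖g‖ ^ 2 / n - 1) hN'
    have h5 := abs_sub_le (fieldCDF (uniformSphere (d + 1)) (featureVector Y) g (u * r))
      (normalCDF (u * r)) (normalCDF u)
    have h6 : (5 : ℝ) / (2 * N) = 3 / (2 * N) + 2 * (1 / (2 * N)) := by
      field_simp
      norm_num
    rw [h6]
    linarith

/-- The bound for the mean defect obtained from comparison at the `N`-quantiles: the discretization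
error, the sum of the variances at the quantiles, and the fluctuation of the norm. -/
lemma IsHarmonicBasis.integral_gaussianDefect_le_grid [NeZero n] (hY : IsHarmonicBasis d ℓ Y)
    {v : ℝ} (hvi : Integrable (fun g => (‖g‖ ^ 2 / n - 1) ^ 2)
      (stdGaussian (EuclideanSpace ℝ (Fin n))))
    (hv : ∫ g, (‖g‖ ^ 2 / n - 1) ^ 2 ∂(stdGaussian (EuclideanSpace ℝ (Fin n))) = v / n)
    {N : ℕ} (hN : 0 < N) :
    ∫ α, gaussianDefect Y α ∂(uniformSphere n) ≤ 5 / (2 * N) + 9 / 2 * (N ^ 2 / n) +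
      v * (N / n) := by
  have hN' : (0 : ℝ) < N := by exact_mod_cast hN
  have hex : ∀ i ∈ Finset.Ico 1 N, ∃ u, normalCDF u = i / N := by
    intro i hi
    rw [Finset.mem_Ico] at hi
    refine exists_normalCDF_eq (div_pos (by exact_mod_cast hi.1) hN') ?_
    rw [div_lt_one hN']
    exact_mod_cast hi.2
  choose! t ht using hex
  have hvar := fun u => integral_fieldCDF_sub_sq_le (uniformSphere (d + 1))
    hY.continuous_featureVector.measurable hY.norm_featureVector u
  have hvar' : ∀ u, ∫ g, (fieldCDF (uniformSphere (d + 1)) (featureVector Y) g u -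
      normalCDF u) ^ 2 ∂(stdGaussian (EuclideanSpace ℝ (Fin n))) ≤ 9 / n := by
    intro u
    refine (hvar u).2.trans ?_
    rw [hY.integral_kernel_sq]
    have h1 := hY.integral_kernel_le
    have h2 : normalPDF u ^ 2 ≤ 1 := pow_le_one₀ (normalPDF_nonneg u) (normalPDF_le_one u)
    have h3 : (0 : ℝ) ≤ 1 / n := by positivity
    have h4 := mul_le_mul_of_nonneg_right h1 (sq_nonneg (normalPDF u))
    have h5 := mul_le_mul_of_nonneg_left h2 h3
    calc _ ≤ 1 / (n : ℝ) * 1 + 8 * (1 / n) := by linarith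
      _ = 9 / n := by ring
  have hi1 : Integrable (fun g => ∑ i ∈ Finset.Ico 1 N,
      (fieldCDF (uniformSphere (d + 1)) (featureVector Y) g (t i) - normalCDF (t i)) ^ 2)
      (stdGaussian (EuclideanSpace ℝ (Fin n))) :=
    integrable_finsetSum _ fun i _ => (hvar (t i)).1
  have hi2 : Integrable (fun g => 5 / (2 * (N : ℝ)) + N / 2 * (∑ i ∈ Finset.Ico 1 N,
      (fieldCDF (uniformSphere (d + 1)) (featureVector Y) g (t i) - normalCDF (t i)) ^ 2))
      (stdGaussian (EuclideanSpace ℝ (Fin n))) := (integrable_const _).add (hi1.const_mul _)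
  rw [integral_uniformSphere_eq_stdGaussian]
  calc _ ≤ ∫ g, (5 / (2 * (N : ℝ)) + N / 2 * (∑ i ∈ Finset.Ico 1 N,
        (fieldCDF (uniformSphere (d + 1)) (featureVector Y) g (t i) - normalCDF (t i)) ^ 2) +
        N * (‖g‖ ^ 2 / n - 1) ^ 2) ∂(stdGaussian (EuclideanSpace ℝ (Fin n))) := by
        refine integral_mono_of_nonneg (Eventually.of_forall fun g => ?_)
          (hi2.add (hvi.const_mul _))
          (Eventually.of_forall fun g => hY.radialExtension_gaussianDefect_le hN ht g)
        rw [Pi.zero_apply, radialExtension]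
        split_ifs
        · exact le_rfl
        · exact gaussianDefect_nonneg _
    _ = 5 / (2 * (N : ℝ)) + N / 2 * (∑ i ∈ Finset.Ico 1 N, ∫ g,
        (fieldCDF (uniformSphere (d + 1)) (featureVector Y) g (t i) - normalCDF (t i)) ^ 2
          ∂(stdGaussian (EuclideanSpace ℝ (Fin n)))) + N * (v / n) := by
        rw [integral_add hi2 (hvi.const_mul _), integral_add (integrable_const _)
          (hi1.const_mul _), integral_const_mul, integral_const_mul, hv,
          integral_finsetSum _ fun i _ => (hvar (t i)).1]
        simp
    _ ≤ 5 / (2 * (N : ℝ)) + N / 2 * (N * (9 / n)) + N * (v / n) := by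
        gcongr
        calc _ ≤ ∑ _i ∈ Finset.Ico 1 N, (9 / n : ℝ) := Finset.sum_le_sum fun i _ => hvar' (t i)
          _ = ((N - 1 : ℕ) : ℝ) * (9 / n) := by simp
          _ ≤ N * (9 / n) := by
            gcongr
            exact Nat.sub_le N 1
    _ = _ := by ring

end

/-- The mean defect is at most a universal constant times `n ^ (-1/3)`, where `n` is the dimension of
the eigenspace. -/
theorem exists_integral_gaussianDefect_le : ∃ C : ℝ, 0 ≤ C ∧ ∀ {d ℓ n : ℕ} [NeZero n]
    {Y : Fin n → UnitSphere (d + 1) → ℝ}, IsHarmonicBasis d ℓ Y →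
    ∫ α, gaussianDefect Y α ∂(uniformSphere n) ≤ C * (n : ℝ) ^ (-(1 / 3) : ℝ) := by
  obtain ⟨v, hv0, hv⟩ := exists_integral_normSq_sub_one_sq_stdGaussian
  refine ⟨5 / 2 + 18 + 4 * v, by positivity, fun {d ℓ n} _ Y hY => ?_⟩
  have hn : (1 : ℝ) ≤ n := by exact_mod_cast NeZero.one_le
  have hn0 : (0 : ℝ) < n := by linarith
  set a : ℝ := (n : ℝ) ^ (1 / 3 : ℝ) with ha
  have ha1 : 1 ≤ a := Real.one_le_rpow hn (by norm_num)
  have ha0 : 0 < a := by linarith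
  have ha3 : a ^ 3 = n := by
    rw [ha, ← Real.rpow_natCast, ← Real.rpow_mul hn0.le]
    norm_num
  rw [Real.rpow_neg hn0.le, ← ha]
  -- the optimal grid has about `n ^ (1/3)` points
  set N := ⌈a⌉₊ with hN
  have hN1 : a ≤ N := Nat.le_ceil a
  have hN2 : (N : ℝ) ≤ 2 * a := by
    have := Nat.ceil_lt_add_one ha0.le
    linarith
  have hN0 : 0 < N := Nat.ceil_pos.2 ha0
  obtain ⟨hvi, hvv⟩ := hv n (NeZero.ne n)
  refine (hY.integral_gaussianDefect_le_grid hvi hvv hN0).trans ?_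
  have hN0' : (0 : ℝ) < N := by exact_mod_cast hN0
  have hNN : (1 : ℝ) ≤ N := by linarith
  have e1 : 5 / (2 * (N : ℝ)) ≤ 5 / 2 * a⁻¹ := by
    rw [← div_eq_mul_inv, div_div]
    gcongr
  have e2 : (N : ℝ) ^ 2 / n ≤ 4 * a⁻¹ := by
    rw [← ha3, div_le_iff₀ (by positivity)]
    calc (N : ℝ) ^ 2 ≤ (2 * a) ^ 2 := by gcongr
      _ = 4 * a⁻¹ * a ^ 3 := by field_simp; ring
  have e3 : (N : ℝ) / n ≤ 4 * a⁻¹ := by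
    refine le_trans ?_ e2
    gcongr
    nlinarith
  have e4 := mul_le_mul_of_nonneg_left e3 hv0
  linarith

/-! ### Integrability of the defect and the asymptotic bounds -/

lemma abs_measureReal_Iic_sub_le_one (P Q : Measure ℝ) [IsProbabilityMeasure P]
    [IsProbabilityMeasure Q] (u : ℝ) :
    |P.real (Set.Iic u) - Q.real (Set.Iic u)| ≤ 1 := by
  have h1 : P.real (Set.Iic u) ≤ 1 := measureReal_le_one
  have h2 : Q.real (Set.Iic u) ≤ 1 := measureReal_le_one
  have h3 : 0 ≤ P.real (Set.Iic u) := measureReal_nonneg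
  have h4 : 0 ≤ Q.real (Set.Iic u) := measureReal_nonneg
  rw [abs_le]
  constructor <;> linarith

/-- Distribution functions being right continuous, the supremum in the Kolmogorov distance may be
taken over rational levels. -/
lemma kolmogorovDist_eq_iSup_rat (P Q : Measure ℝ) [IsProbabilityMeasure P]
    [IsProbabilityMeasure Q] :
    kolmogorovDist P Q = ⨆ q : ℚ, |P.real (Set.Iic (q : ℝ)) - Q.real (Set.Iic (q : ℝ))| := by
  have hb := abs_measureReal_Iic_sub_le_one P Q
  refine le_antisymm (ciSup_le fun u => ?_) (ciSup_le fun q => ?_)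
  · have hc : ContinuousWithinAt (fun v => |P.real (Set.Iic v) - Q.real (Set.Iic v)|)
        (Set.Ioi u) u := by
      have h1 := ((cdf P).right_continuous u).mono Set.Ioi_subset_Ici_self
      have h2 := ((cdf Q).right_continuous u).mono Set.Ioi_subset_Ici_self
      have := (h1.sub h2).abs
      simpa only [Pi.sub_apply, cdf_eq_real] using this
    refine le_of_forall_pos_lt_add fun ε hε => ?_
    have hev := hc.eventually (lt_mem_nhds (sub_lt_self _ hε))
    obtain ⟨c, hc1, hc2⟩ := mem_nhdsGT_iff_exists_Ioo_subset.1 hev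
    obtain ⟨q, hq1, hq2⟩ := exists_rat_btwn (Set.mem_Ioi.1 hc1)
    have h1 := hc2 ⟨hq1, hq2⟩
    have h2 := le_ciSup (f := fun q : ℚ => |P.real (Set.Iic (q : ℝ)) - Q.real (Set.Iic (q : ℝ))|)
      ⟨1, by rintro _ ⟨q, rfl⟩; exact hb q⟩ q
    simp only [Set.mem_ofPred_eq] at h1
    linarith
  · exact le_ciSup (f := fun u : ℝ => |P.real (Set.Iic u) - Q.real (Set.Iic u)|)
      ⟨1, by rintro _ ⟨u, rfl⟩; exact hb u⟩ (q : ℝ)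

/-- The defect takes values in `[0, 1]`, and it is measurable because it is a supremum over countably
many levels. -/
theorem IsHarmonicBasis.integrable_gaussianDefect {d ℓ n : ℕ} [NeZero n]
    {Y : Fin n → UnitSphere (d + 1) → ℝ} (hY : IsHarmonicBasis d ℓ Y) :
    Integrable (gaussianDefect Y) (uniformSphere n) := by
  have hprob : ∀ α, IsProbabilityMeasure ((uniformSphere (d + 1)).map (eigenfunction Y α)) :=
    fun α => Measure.isProbabilityMeasure_map (hY.measurable_eigenfunction α).aemeasurable
  have hm : ∀ u : ℝ, Measurable fun α : UnitSphere n =>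
      (uniformSphere (d + 1)).real {x | eigenfunction Y α x ≤ u} := by
    intro u
    have hA : MeasurableSet {p : UnitSphere n × UnitSphere (d + 1) |
        eigenfunction Y p.1 p.2 ≤ u} := by
      refine measurableSet_le ?_ measurable_const
      refine Continuous.measurable (continuous_finsetSum _ fun m _ => ?_)
      have h1 : Continuous fun p : UnitSphere n × UnitSphere (d + 1) =>
          (p.1 : EuclideanSpace ℝ (Fin n)) m := by fun_prop
      exact h1.mul ((hY.continuous m).comp continuous_snd)
    exact (measurable_measure_prodMk_left hA).ennreal_toReal
  have hmeas : Measurable (gaussianDefect Y) := by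
    have : gaussianDefect Y = fun α => ⨆ q : ℚ,
        |(uniformSphere (d + 1)).real {x | eigenfunction Y α x ≤ (q : ℝ)} - normalCDF q| := by
      ext α
      rw [gaussianDefect, kolmogorovDist_eq_iSup_rat]
      simp only [hY.map_real_Iic, normalCDF]
    rw [this]
    exact Measurable.iSup fun q => ((hm q).sub_const _).abs
  refine integrable_of_measurable_of_abs_le hmeas 1 fun α => ?_
  rw [abs_of_nonneg (gaussianDefect_nonneg α)]
  exact ciSup_le fun u => abs_measureReal_Iic_sub_le_one _ _ u

lemma rpow_neg_third_le {n D c : ℝ} (hD : 0 < D) (hc : 0 < c) (h : D / c ≤ n) :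
    n ^ (-(1 / 3) : ℝ) ≤ c ^ (1 / 3 : ℝ) * D ^ (-(1 / 3) : ℝ) := by
  calc n ^ (-(1 / 3) : ℝ) ≤ (D / c) ^ (-(1 / 3) : ℝ) :=
        Real.rpow_le_rpow_of_nonpos (by positivity) h (by norm_num)
    _ = _ := by
        rw [Real.div_rpow hD.le hc.le, Real.rpow_neg hc.le, div_inv_eq_mul, mul_comm]

theorem corollary2 (n : ℕ → ℕ → ℕ)
    (Y : ∀ d ℓ : ℕ, Fin (n d ℓ) → UnitSphere (d + 1) → ℝ)
    (hY : ∀ d ℓ : ℕ, 2 ≤ d → IsHarmonicBasis d ℓ (Y d ℓ)) :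
    (∀ d ℓ : ℕ, 2 ≤ d →
      Integrable (fun α => gaussianDefect (Y d ℓ) α) (uniformSphere (n d ℓ))) ∧
    (∀ ℓ : ℕ,
      (fun d : ℕ => ∫ α, gaussianDefect (Y d ℓ) α ∂(uniformSphere (n d ℓ)))
        =O[atTop] fun d : ℕ => 1 / (d : ℝ) ^ ((ℓ : ℝ) / 3)) ∧
    (∀ d : ℕ, 2 ≤ d →
      (fun ℓ : ℕ => ∫ α, gaussianDefect (Y d ℓ) α ∂(uniformSphere (n d ℓ)))
        =O[atTop] fun ℓ : ℕ => 1 / (ℓ : ℝ) ^ (((d : ℝ) - 1) / 3)) := by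
  have hdim : ∀ d ℓ, 2 ≤ d → (ℓ + d - 1).choose (d - 1) ≤ n d ℓ := fun d ℓ hd =>
    (hY d ℓ hd).choose_le (by omega)
  have hne : ∀ d ℓ, 2 ≤ d → NeZero (n d ℓ) := fun d ℓ hd =>
    ⟨((Nat.choose_pos (by omega)).trans_le (hdim d ℓ hd)).ne'⟩
  obtain ⟨C, hC0, hC⟩ := exists_integral_gaussianDefect_le
  have hbound : ∀ d ℓ, 2 ≤ d → ‖∫ α, gaussianDefect (Y d ℓ) α ∂(uniformSphere (n d ℓ))‖ ≤
      C * (n d ℓ : ℝ) ^ (-(1 / 3) : ℝ) := by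
    intro d ℓ hd
    have := hne d ℓ hd
    rw [Real.norm_of_nonneg (integral_nonneg fun α => gaussianDefect_nonneg α)]
    exact hC (hY d ℓ hd)
  refine ⟨fun d ℓ hd => ?_, fun ℓ => ?_, fun d hd => ?_⟩
  · have := hne d ℓ hd
    exact (hY d ℓ hd).integrable_gaussianDefect
  · refine IsBigO.of_bound (C * (ℓ.factorial : ℝ) ^ (1 / 3 : ℝ)) ?_
    filter_upwards [eventually_ge_atTop 2] with d hd
    have hd0 : (0 : ℝ) < d := by exact_mod_cast (by omega : 0 < d)
    have h1 : (d : ℝ) ^ ℓ / ℓ.factorial ≤ n d ℓ := by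
      refine le_trans ?_ (Nat.cast_le.2 (hdim d ℓ hd))
      have := Nat.pow_le_choose (α := ℝ) ℓ (ℓ + d - 1)
      rw [show ℓ + d - 1 + 1 - ℓ = d by omega] at this
      rwa [← Nat.choose_symm_of_eq_add (show ℓ + d - 1 = ℓ + (d - 1) by omega)]
    refine (hbound d ℓ hd).trans ?_
    rw [mul_assoc]
    refine mul_le_mul_of_nonneg_left ((rpow_neg_third_le (by positivity)
      (by exact_mod_cast ℓ.factorial_pos) h1).trans (le_of_eq ?_)) hC0
    rw [Real.norm_of_nonneg (by positivity), one_div ((d : ℝ) ^ _), ← Real.rpow_neg hd0.le,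
      ← Real.rpow_natCast, ← Real.rpow_mul hd0.le]
    congr 2
    ring
  · refine IsBigO.of_bound (C * ((d - 1).factorial : ℝ) ^ (1 / 3 : ℝ)) ?_
    filter_upwards [eventually_ge_atTop 1] with ℓ hℓ
    have hl0 : (0 : ℝ) < ℓ := by exact_mod_cast hℓ
    have h1 : (ℓ : ℝ) ^ (d - 1) / (d - 1).factorial ≤ n d ℓ := by
      refine le_trans ?_ (Nat.cast_le.2 (hdim d ℓ hd))
      refine le_trans ?_ (Nat.pow_le_choose (α := ℝ) (d - 1) (ℓ + d - 1))
      rw [show ℓ + d - 1 + 1 - (d - 1) = ℓ + 1 by omega]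
      gcongr
      linarith
    refine (hbound d ℓ hd).trans ?_
    rw [mul_assoc]
    refine mul_le_mul_of_nonneg_left ((rpow_neg_third_le (by positivity)
      (by exact_mod_cast (d - 1).factorial_pos) h1).trans (le_of_eq ?_)) hC0
    rw [Real.norm_of_nonneg (by positivity), one_div ((ℓ : ℝ) ^ _), ← Real.rpow_neg hl0.le,
      ← Real.rpow_natCast, ← Real.rpow_mul hl0.le, Nat.cast_sub (by omega : 1 ≤ d)]
    congr 2
    push_cast
    ring
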